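/- **Proposition 3.4.** Let $(p_k)_{k\in\mathbb N}$ be a discrete probability distribution with $p_k>0$ for infinitely many $k$. Balls $1,2,\dots$ are thrown independently into boxes $1,2,\dots$, each ball hitting box $k$ with probability $p_k$. For $j,n\in\mathbb N$ let $\mathcal K_j(n)$ be the number of boxes that contain at least $j$ of the first $n$ balls (deterministic scheme). Let $S_n$ ($n\in\mathbb N$) be the partial sums of i.i.d. exponential random variables of unit mean which are independent of the boxes hit by the balls, and let $K_j(t)$, $t\ge 0$, be the number of boxes that contain at least $j$ balls at time $t$ when the $n$th ball is thrown at time $S_n$ (Poissonized scheme). Put $\rho(t)=\#\{k\in\mathbb N: 1/p_k\le t\}$ for $t>0$ (with $1/0=\infty$). Assume that one of the following holds: (i) there is a function $\ell$ with $\lim_{t\to\infty}\ell(t)=\infty$ such that $\lim_{t\to\infty}\frac{\rho(\lambda t)-\rho(t)}{\ell(t)}=\log\lambda$ for all $\lambda>0$ (that is, $\rho\in\Pi_{\ell,\infty}$); (ii) $\rho$ is regularly varying at $\infty$ of some index $\alpha\in(0,1]$, that is, $\rho(t)\sim t^\alpha L(t)$ as $t\to\infty$ for some $L$ slowly varying at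 $\infty$. Then, for every $j\in\mathbb N$ (that is, $j\ge1$), the variables $\mathcal K_j(n)$ and $K_j(n)$ are square integrable for all $n\in\mathbb N$, and $$\lim_{n\to\infty}\frac{\mathrm{Var}\,\mathcal K_j(n)}{\mathrm{Var}\,K_j(n)}=1.$$ -/

import Mathlib

open MeasureTheory ProbabilityTheory Filter Topology

namespace Karlin

noncomputable section

/-- `ρ(t) = #{k : 1 / p_k ≤ t}`, with the convention `1 / 0 = ∞`: boxes of probability zero
are never counted. For `t > 0` and summable `p` the set is finite. -/
def rho (p : ℕ → ℝ) (t : ℝ) : ℝ :=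
  ({k : ℕ | 0 < p k ∧ 1 / p k ≤ t}.ncard : ℝ)

/-- `L` is slowly varying at infinity: measurable, eventually positive, and
`L(λ t) / L(t) → 1` for every `λ > 0`. -/
structure SlowlyVarying (L : ℝ → ℝ) : Prop where
  measurable : Measurable L
  eventually_pos : ∀ᶠ t in atTop, 0 < L t
  tendsto_ratio : ∀ c : ℝ, 0 < c → Tendsto (fun t => L (c * t) / L t) atTop (𝓝 1)

/-- `f` is regularly varying at infinity of index `α`: `f(t) ~ t ^ α * L(t)` for some `L`
slowly varying at infinity. -/
def RegularlyVarying (f : ℝ → ℝ) (α : ℝ) : Prop :=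
  ∃ L : ℝ → ℝ, SlowlyVarying L ∧ Tendsto (fun t => f t / (t ^ α * L t)) atTop (𝓝 1)

/-- `f` belongs to de Haan's class `Π` with the auxiliary function `ℓ`. -/
def DeHaanClass (f ℓ : ℝ → ℝ) : Prop :=
  ∀ c : ℝ, 0 < c → Tendsto (fun t => (f (c * t) - f t) / ℓ t) atTop (𝓝 (Real.log c))

/-- `f` belongs to de Haan's class `Π` with an auxiliary function that diverges to infinity. -/
def DeHaanClassInfty (f : ℝ → ℝ) : Prop :=
  ∃ ℓ : ℝ → ℝ, DeHaanClass f ℓ ∧ Tendsto ℓ atTop atTop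

variable {Ω : Type*}

/-- The random input of the occupancy scheme with hitting probabilities `p`. Balls are numbered
from `0`; `X m` is the index of the box hit by ball `m`; the `ξ m` are the increments of the
standard exponential random walk at whose epochs the balls are thrown in the Poissonized version.
All these variables are independent. -/
structure IsScheme [MeasurableSpace Ω] (P : Measure Ω) (p : ℕ → ℝ)
    (X : ℕ → Ω → ℕ) (ξ : ℕ → Ω → ℝ) : Prop where
  measurable_box : ∀ m, Measurable (X m)
  law_box : ∀ m k, P.real {ω | X m ω = k} = p k
  indep_box : iIndepFun X P
  measurable_incr : ∀ m, Measurable (ξ m)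
  law_incr : ∀ m, P.map (ξ m) = expMeasure 1
  indep_incr : iIndepFun ξ P
  indep_box_incr : IndepFun (fun ω m => X m ω) (fun ω m => ξ m ω) P

/-- The time at which ball `m` (counted from `0`) is thrown in the Poissonized version: the
position `ξ 0 + ⋯ + ξ m` of the random walk after `m + 1` steps. -/
def arrival (ξ : ℕ → Ω → ℝ) (m : ℕ) (ω : Ω) : ℝ :=
  ∑ i ∈ Finset.range (m + 1), ξ i ω

/-- Deterministic version: the number of boxes that contain at least `j` of the first `n` balls. -/
def detCount (X : ℕ → Ω → ℕ) (j n : ℕ) (ω : Ω) : ℝ :=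
  ({k : ℕ | j ≤ {m : ℕ | m < n ∧ X m ω = k}.ncard}.ncard : ℝ)

/-- Poissonized version: the number of boxes that contain at least `j` balls at time `t`.
Almost surely only finitely many balls have been thrown by time `t`. -/
def poissonCount (X : ℕ → Ω → ℕ) (ξ : ℕ → Ω → ℝ) (j : ℕ) (t : ℝ) (ω : Ω) : ℝ :=
  ({k : ℕ | j ≤ {m : ℕ | arrival ξ m ω ≤ t ∧ X m ω = k}.ncard}.ncard : ℝ)

end

end Karlin

namespace Karlin

noncomputable section

/-! A count of occupied boxes is a sum of indicators, so its variance is the double sum of their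
covariances. Let `j = i + 1`. In the Poissonized scheme distinct boxes are uncorrelated, and `Var
K_j(n)` is V = ∑ q_k (1 - q_k) with q_k = `poissonTail (n * p k) j`. In the deterministic scheme the
diagonal contains binomial tails and the off-diagonal terms are small covariances.

Both discrepancies satisfy recursions in the number of balls with explicit source terms. Comparison
with a supersolution (`envelope`) gives `abs_tailCov_le` and `abs_binTail_sub_poissonTail_le`.
Summed over boxes, they bound the difference of the variances by a constant times (W + W²) / n,
where W = `totalWeight p i n` is the sum of `weight i (n * p k)` (`abs_variance_sub_le`).

Dominated convergence yields W = o(n) (`tendsto_totalWeight_div`), so it suffices that W = O(V).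
Only here does the regularity of `rho` enter. It implies that the number of boxes with s p_k in [1,
2) at most doubles when a large s is halved. Boxes with n p_k ≤ 1 have weight comparable to their
variance; a dyadic sum bounds the heavier ones by the single block at scale n, which is itself O(V);
a fixed finite set of boxes is negligible (`eventually_totalWeight_le`). -/

/-! ### Binomial, multinomial and Poisson tails -/

/-- The probability that, after `m` independent balls, two distinct boxes with hitting
probabilities `p` and `q` contain at least `a` and at least `b` balls. -/
def jointTail (p q : ℝ) : ℕ → ℕ → ℕ → ℝ
  | 0, a, b => if a = 0 ∧ b = 0 then 1 else 0
  | m + 1, a, b => p * jointTail p q m (a - 1) b + q * jointTail p q m a (b - 1)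
      + (1 - p - q) * jointTail p q m a b

/-- The upper tail of the binomial distribution. -/
def binTail (p : ℝ) : ℕ → ℕ → ℝ
  | 0, a => if a = 0 then 1 else 0
  | m + 1, a => p * binTail p m (a - 1) + (1 - p) * binTail p m a

/-- The point masses of the Poisson distribution with mean `x`. -/
def poissonMass (x : ℝ) (a : ℕ) : ℝ := Real.exp (-x) * x ^ a / a.factorial

/-- The upper tail of the Poisson distribution with mean `x`. -/
def poissonTail (x : ℝ) (a : ℕ) : ℝ := 1 - ∑ i ∈ Finset.range a, poissonMass x i

/-- A supersolution of the recursion satisfied by the binomial point masses. -/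
def envelope (p : ℝ) (m a : ℕ) : ℝ :=
  (m * (Real.exp 1 * p)) ^ a / a.factorial * Real.exp (-(m * p))

@[simp] lemma poissonTail_zero (x : ℝ) : poissonTail x 0 = 1 := by simp [poissonTail]

lemma poissonTail_succ (x : ℝ) (a : ℕ) :
    poissonTail x (a + 1) = poissonTail x a - poissonMass x a := by
  simp only [poissonTail, Finset.sum_range_succ]; ring

@[simp] lemma binTail_zero_right (p : ℝ) (m : ℕ) : binTail p m 0 = 1 := by
  induction m with
  | zero => simp [binTail]
  | succ m ih => simp only [binTail, Nat.zero_sub, ih]; ring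

lemma jointTail_zero_right (p q : ℝ) (m a : ℕ) : jointTail p q m a 0 = binTail p m a := by
  induction m generalizing a with
  | zero => simp [binTail, jointTail]
  | succ m ih => simp only [binTail, jointTail, Nat.zero_sub, ih]; ring

lemma jointTail_zero_left (p q : ℝ) (m b : ℕ) : jointTail p q m 0 b = binTail q m b := by
  induction m generalizing b with
  | zero => simp [binTail, jointTail]
  | succ m ih => simp only [binTail, jointTail, Nat.zero_sub, ih]; ring

lemma binTail_sub_succ (p : ℝ) (m a : ℕ) :
    binTail p m a - binTail p m (a + 1) = m.choose a * p ^ a * (1 - p) ^ (m - a) := by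
  induction m generalizing a with
  | zero => cases a <;> simp [binTail]
  | succ m ih =>
    cases a with
    | zero =>
      have h := ih 0
      simp only [binTail, Nat.zero_sub, binTail_zero_right, zero_add, Nat.sub_self,
        Nat.choose_zero_right, pow_zero, Nat.sub_zero, pow_succ] at h ⊢
      linear_combination (1 - p) * h
    | succ a =>
      have h := ih a
      have h' := ih (a + 1)
      simp only [binTail, Nat.add_sub_cancel, Nat.choose_succ_succ, Nat.cast_add,
        Nat.reduceSubDiff] at h h' ⊢
      -- Truncated subtraction breaks the power identity when `m < a + 1`; the vanishing binomial
      -- coefficient covers that case.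
      have e : (m.choose (a + 1) : ℝ) * (1 - p) ^ (m - a)
          = m.choose (a + 1) * ((1 - p) * (1 - p) ^ (m - (a + 1))) := by
        rcases le_or_gt (a + 1) m with hle | hlt
        · rw [← pow_succ', show m - (a + 1) + 1 = m - a by omega]
        · simp [Nat.choose_eq_zero_of_lt hlt]
      linear_combination p * h + (1 - p) * h' - p ^ (a + 1) * e

/-- The mixed second difference of a joint tail is a trinomial point mass. It is factored through
`m.choose (a + b)` to match `hasSum_poissonMass_choose`. -/
lemma jointTail_second_diff (p q : ℝ) (m a b : ℕ) :
    jointTail p q m a b - jointTail p q m (a + 1) b - jointTail p q m a (b + 1)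
      + jointTail p q m (a + 1) (b + 1)
    = (a + b).choose a * p ^ a * q ^ b * (m.choose (a + b) * (1 - p - q) ^ (m - (a + b))) := by
  induction m generalizing a b with
  | zero =>
    rcases a with _ | a <;> rcases b with _ | b <;> simp [jointTail]
    exact Or.inr (Nat.choose_eq_zero_of_lt (by omega))
  | succ m ih =>
    have e : ∀ c, (m.choose (c + 1) : ℝ) * (1 - p - q) ^ (m - c)
          = m.choose (c + 1) * ((1 - p - q) * (1 - p - q) ^ (m - (c + 1))) := by
      intro c
      rcases le_or_gt (c + 1) m with hle | hlt
      · rw [← pow_succ', show m - (c + 1) + 1 = m - c by omega]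
      · simp [Nat.choose_eq_zero_of_lt hlt]
    rcases a with _ | a <;> rcases b with _ | b
    · have h := ih 0 0
      simp only [jointTail, Nat.zero_sub, zero_add, Nat.sub_self,
        Nat.choose_zero_right, pow_zero, Nat.sub_zero, pow_succ] at h ⊢
      linear_combination (1 - p - q) * h
    · have h := ih 0 b
      have h' := ih 0 (b + 1)
      have e' := e b
      simp only [jointTail, Nat.zero_sub, zero_add, Nat.add_sub_cancel,
        Nat.choose_zero_right, pow_zero, Nat.choose_succ_succ, Nat.cast_add,
        Nat.reduceSubDiff] at h h' ⊢
      linear_combination q * h + (1 - p - q) * h' - q ^ (b + 1) * e'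
    · have h := ih a 0
      have h' := ih (a + 1) 0
      have e' := e a
      simp only [jointTail, Nat.zero_sub, add_zero, zero_add, Nat.add_sub_cancel,
        Nat.choose_self, pow_zero, Nat.choose_succ_succ, Nat.cast_add,
        Nat.reduceSubDiff] at h h' ⊢
      linear_combination p * h + (1 - p - q) * h' - p ^ (a + 1) * e'
    · have h := ih a (b + 1)
      have h1 := ih (a + 1) b
      have h' := ih (a + 1) (b + 1)
      have e' := e (a + b + 1)
      rw [show a + (b + 1) = a + b + 1 by ring] at h
      rw [show a + 1 + b = a + b + 1 by ring] at h1
      rw [show a + 1 + (b + 1) = a + b + 1 + 1 by ring] at h' ⊢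
      have p1 : ((a + b + 1 + 1).choose (a + 1) : ℝ)
          = (a + b + 1).choose a + (a + b + 1).choose (a + 1) := by
        rw [Nat.choose_succ_succ]; push_cast; ring
      have p2 : ((m + 1).choose (a + b + 1 + 1) : ℝ)
          = m.choose (a + b + 1) + m.choose (a + b + 1 + 1) := by
        rw [Nat.choose_succ_succ]; push_cast; ring
      rw [p1] at h'
      rw [p1, p2, show m + 1 - (a + b + 1 + 1) = m - (a + b + 1) by omega]
      simp only [jointTail, Nat.add_sub_cancel] at h h1 h' ⊢
      linear_combination p * h + q * h1 + (1 - p - q) * h' - 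
        (((a + b + 1).choose a : ℝ) + (a + b + 1).choose (a + 1)) * p ^ (a + 1) * q ^ (b + 1) * e'

/-! ### The envelope as a supersolution -/

lemma envelope_nonneg {p : ℝ} (hp : 0 ≤ p) (m a : ℕ) : 0 ≤ envelope p m a := by
  unfold envelope; positivity

/-- These are the first two terms of the binomial expansion. -/
lemma pow_add_succ_mul_le {x y : ℝ} (hx : 0 ≤ x) (hy : 0 ≤ y) (a : ℕ) :
    x ^ (a + 1) + (a + 1) * y * x ^ a ≤ (x + y) ^ (a + 1) := by
  induction a with
  | zero => simp
  | succ a ih =>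
    rw [pow_succ (x + y)]
    refine le_trans ?_ (mul_le_mul_of_nonneg_right ih (by positivity))
    push_cast
    have : 0 ≤ (a + 1) * y * x ^ a * y := by positivity
    have e : (x ^ (a + 1) + (↑a + 1) * y * x ^ a) * (x + y)
      = x ^ (a + 1 + 1) + (↑a + 1 + 1) * y * x ^ (a + 1) + (a + 1) * y * x ^ a * y := by ring
    rw [e]; linarith

lemma pow_div_factorial_step {x y : ℝ} (hx : 0 ≤ x) (hy : 0 ≤ y) (a : ℕ) :
    x ^ (a + 1) / (a + 1).factorial + y * (x ^ a / a.factorial)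
      ≤ (x + y) ^ (a + 1) / (a + 1).factorial := by
  have h : y * (x ^ a / a.factorial) = (a + 1) * y * x ^ a / (a + 1).factorial := by
    rw [Nat.factorial_succ]; push_cast; field_simp
  rw [h, ← add_div]
  gcongr
  exact pow_add_succ_mul_le hx hy a

/-- The polynomial part of `envelope`. -/
def envelopePoly (p : ℝ) (m a : ℕ) : ℝ := (m * (Real.exp 1 * p)) ^ a / a.factorial

lemma envelopePoly_nonneg {p : ℝ} (hp : 0 ≤ p) (m a : ℕ) : 0 ≤ envelopePoly p m a := by
  unfold envelopePoly; positivity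

lemma envelopePoly_succ_le {p : ℝ} (hp : 0 ≤ p) (m a : ℕ) :
    envelopePoly p m (a + 1) + Real.exp 1 * p * envelopePoly p m a
      ≤ envelopePoly p (m + 1) (a + 1) := by
  unfold envelopePoly
  have := pow_div_factorial_step (x := m * (Real.exp 1 * p)) (y := Real.exp 1 * p)
    (by positivity) (by positivity) a
  refine this.trans (le_of_eq ?_)
  push_cast; ring

lemma envelopePoly_mono {p : ℝ} (hp : 0 ≤ p) (m a : ℕ) :
    envelopePoly p m a ≤ envelopePoly p (m + 1) a := by
  unfold envelopePoly
  gcongr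
  simp

lemma envelope_eq (p : ℝ) (m a : ℕ) :
    envelope p m a = envelopePoly p m a * Real.exp (-(m * p)) := rfl

lemma envelope_succ_eq (p : ℝ) (m a : ℕ) :
    envelope p (m + 1) a = envelopePoly p (m + 1) a * Real.exp (-p) * Real.exp (-(m * p)) := by
  rw [envelope_eq, mul_assoc, ← Real.exp_add]
  congr 2; push_cast; ring

/-- This is the purpose of the factor e inside `envelope`: whenever a ball hits the box, one such
factor pays for the decay of the exponential in that step. -/
lemma le_exp_one_mul_exp_neg {s : ℝ} (hs : s ≤ 1) : 1 ≤ Real.exp 1 * Real.exp (-s) := by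
  rw [← Real.exp_add]; exact Real.one_le_exp (by linarith)

lemma envelope_step_zero {p : ℝ} (m : ℕ) :
    (1 - p) * envelope p m 0 ≤ envelope p (m + 1) 0 := by
  rw [envelope_succ_eq, envelope_eq]
  have h := Real.add_one_le_exp (-p)
  simp only [envelopePoly, pow_zero, Nat.factorial_zero, Nat.cast_one, div_one, one_mul]
  exact mul_le_mul_of_nonneg_right (by linarith) (Real.exp_pos _).le

/-- A miss costs 1 - p ≤ exp (-p); a hit is paid for by the spare factor e in the base of the power.
-/
lemma envelope_step {p : ℝ} (hp : 0 ≤ p) (hp1 : p ≤ 1) (m a : ℕ) :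
    p * envelope p m a + (1 - p) * envelope p m (a + 1) ≤ envelope p (m + 1) (a + 1) := by
  rw [envelope_succ_eq, envelope_eq, envelope_eq, ← mul_assoc, ← mul_assoc, ← add_mul]
  refine mul_le_mul_of_nonneg_right ?_ (Real.exp_pos _).le
  have h := Real.add_one_le_exp (-p)
  have h1 := le_exp_one_mul_exp_neg hp1
  have h2 := envelopePoly_succ_le hp m a
  have n1 := envelopePoly_nonneg hp m a
  have n2 := envelopePoly_nonneg hp m (a + 1)
  calc p * envelopePoly p m a + (1 - p) * envelopePoly p m (a + 1)
      ≤ (Real.exp 1 * Real.exp (-p)) * (p * envelopePoly p m a)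
        + Real.exp (-p) * envelopePoly p m (a + 1) := by
        have := mul_le_mul_of_nonneg_right h1 (mul_nonneg hp n1)
        have := mul_le_mul_of_nonneg_right (show 1 - p ≤ Real.exp (-p) by linarith) n2
        linarith
    _ = (envelopePoly p m (a + 1) + Real.exp 1 * p * envelopePoly p m a) * Real.exp (-p) := by
        ring
    _ ≤ _ := mul_le_mul_of_nonneg_right h2 (Real.exp_pos _).le

lemma envelope_shift {p : ℝ} (hp : 0 ≤ p) (m a : ℕ) :
    envelope p m a ≤ Real.exp p * envelope p (m + 1) a := by
  rw [envelope_succ_eq, envelope_eq]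
  have : Real.exp p * (envelopePoly p (m + 1) a * Real.exp (-p) * Real.exp (-(↑m * p)))
    = envelopePoly p (m + 1) a * Real.exp (-(↑m * p)) := by
    rw [Real.exp_neg p]; field_simp
  rw [this]
  exact mul_le_mul_of_nonneg_right (envelopePoly_mono hp m a) (Real.exp_pos _).le

/-- Product of two envelopes, with the recursion of the joint tail. -/
lemma envelope_joint_step {p q : ℝ} (hp : 0 ≤ p) (hq : 0 ≤ q) (hpq : p + q ≤ 1) (m a b : ℕ) :
    (if a = 0 then 0 else p * (envelope p m (a - 1) * envelope q m b))
      + (if b = 0 then 0 else q * (envelope p m a * envelope q m (b - 1)))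
      + (1 - p - q) * (envelope p m a * envelope q m b)
    ≤ envelope p (m + 1) a * envelope q (m + 1) b := by
  rw [envelope_succ_eq, envelope_succ_eq]
  simp only [envelope_eq]
  set E := Real.exp (-(m * p)) * Real.exp (-(m * q)) with hE
  have hE0 : 0 ≤ E := by positivity
  set y := envelopePoly p m with hy
  set z := envelopePoly q m with hz
  set c := Real.exp (-p) * Real.exp (-q) with hc
  have hc' : c = Real.exp (-(p + q)) := by rw [hc, ← Real.exp_add]; congr 1; ring
  have hc0 : 0 ≤ c := by positivity
  -- A ball hits at most one of the two boxes, and p + q ≤ 1, so a single factor e pays for both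
  -- exponentials.
  have h1 : 1 ≤ Real.exp 1 * c := hc' ▸ le_exp_one_mul_exp_neg hpq
  have h2 : 1 - p - q ≤ c := by
    have := Real.add_one_le_exp (-(p + q)); rw [hc']; linarith
  have hy0 : ∀ i, 0 ≤ y i := fun i => envelopePoly_nonneg hp m i
  have hz0 : ∀ i, 0 ≤ z i := fun i => envelopePoly_nonneg hq m i
  have hY : ∀ i, y i + (if i = 0 then 0 else Real.exp 1 * p * y (i - 1))
      ≤ envelopePoly p (m + 1) i := by
    intro i
    rcases i with _ | i
    · simp [hy, envelopePoly]
    · simpa using envelopePoly_succ_le hp m i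
  have hZ : ∀ i, z i + (if i = 0 then 0 else Real.exp 1 * q * z (i - 1))
      ≤ envelopePoly q (m + 1) i := by
    intro i
    rcases i with _ | i
    · simp [hz, envelopePoly]
    · simpa using envelopePoly_succ_le hq m i
  set A : ℝ := if a = 0 then 0 else p * y (a - 1) with hA
  set B : ℝ := if b = 0 then 0 else q * z (b - 1) with hB
  have hA0 : 0 ≤ A := by rw [hA]; split_ifs; exacts [le_rfl, mul_nonneg hp (hy0 _)]
  have hB0 : 0 ≤ B := by rw [hB]; split_ifs; exacts [le_rfl, mul_nonneg hq (hz0 _)]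
  have hYA : y a + Real.exp 1 * A ≤ envelopePoly p (m + 1) a := by
    refine le_trans (le_of_eq ?_) (hY a)
    rw [hA]; split_ifs <;> ring
  have hZB : z b + Real.exp 1 * B ≤ envelopePoly q (m + 1) b := by
    refine le_trans (le_of_eq ?_) (hZ b)
    rw [hB]; split_ifs <;> ring
  have e1 : (if a = 0 then 0 else p * (y (a - 1) * Real.exp (-(↑m * p)) *
      (z b * Real.exp (-(↑m * q))))) = A * z b * E := by
    rw [hA, hE]; split_ifs <;> ring
  have e2 : (if b = 0 then 0 else q * (y a * Real.exp (-(↑m * p)) *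
      (z (b - 1) * Real.exp (-(↑m * q))))) = y a * B * E := by
    rw [hB, hE]; split_ifs <;> ring
  rw [e1, e2]
  have e3 := Real.exp_pos 1
  calc _ = (A * z b + y a * B + (1 - p - q) * (y a * z b)) * E := by rw [hE]; ring
    _ ≤ ((y a + Real.exp 1 * A) * (z b + Real.exp 1 * B) * c) * E := by
        refine mul_le_mul_of_nonneg_right ?_ hE0
        have i1 := mul_le_mul_of_nonneg_right h1 (mul_nonneg hA0 (hz0 b))
        have i2 := mul_le_mul_of_nonneg_right h1 (mul_nonneg (hy0 a) hB0)
        have i3 := mul_le_mul_of_nonneg_right h2 (mul_nonneg (hy0 a) (hz0 b))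
        -- This cross term would correspond to one ball hitting both boxes; it is absent from the
        -- recursion and can be discarded.
        have i4 : 0 ≤ Real.exp 1 * A * (Real.exp 1 * B) * c := by positivity
        linarith
    _ ≤ (envelopePoly p (m + 1) a * envelopePoly q (m + 1) b * c) * E := by
        refine mul_le_mul_of_nonneg_right (mul_le_mul_of_nonneg_right ?_ hc0) hE0
        have := hy0 a
        have := hz0 b
        exact mul_le_mul hYA hZB (by positivity) (envelopePoly_nonneg hp _ _)
    _ = _ := by rw [hE, hc]; ring

/-! ### Bounds for point masses and covariances -/

lemma binTail_sub_nonneg {p : ℝ} (hp : 0 ≤ p) (hp1 : p ≤ 1) (m a : ℕ) :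
    0 ≤ binTail p m a - binTail p m (a + 1) := by
  rw [binTail_sub_succ]
  have : 0 ≤ 1 - p := by linarith
  positivity

lemma binTail_sub_le_envelope {p : ℝ} (hp : 0 ≤ p) (hp1 : p ≤ 1) (m a : ℕ) :
    binTail p m a - binTail p m (a + 1) ≤ envelope p m a := by
  induction m generalizing a with
  | zero => cases a <;> simp [binTail, envelope]
  | succ m ih =>
    cases a with
    | zero =>
      refine le_trans ?_ (envelope_step_zero m)
      have := mul_le_mul_of_nonneg_left (ih 0) (show 0 ≤ 1 - p by linarith)
      refine le_trans (le_of_eq ?_) this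
      simp only [binTail, Nat.zero_sub, zero_add, Nat.sub_self]; ring
    | succ a =>
      refine le_trans ?_ (envelope_step hp hp1 m a)
      have h1 := mul_le_mul_of_nonneg_left (ih (a + 1)) (show 0 ≤ 1 - p by linarith)
      have h2 := mul_le_mul_of_nonneg_left (ih a) hp
      refine le_trans (le_of_eq ?_) (add_le_add h2 h1)
      simp only [binTail, Nat.add_sub_cancel]; ring

/-- Covariance of the events that two boxes contain at least `a`, resp. `b`, balls. -/
def tailCov (p q : ℝ) (m a b : ℕ) : ℝ := jointTail p q m a b - binTail p m a * binTail q m b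

/-- Covariances propagate like joint tails. The source term appears because one ball cannot hit both
boxes, whereas the product of the marginals gives that event weight p q. -/
lemma tailCov_succ (p q : ℝ) (m a b : ℕ) :
    tailCov p q (m + 1) a b = p * tailCov p q m (a - 1) b + q * tailCov p q m a (b - 1)
      + (1 - p - q) * tailCov p q m a b
      - p * q * ((binTail p m (a - 1) - binTail p m a) * (binTail q m (b - 1) - binTail q m b)) := by
  simp only [tailCov, jointTail, binTail]; ring

lemma tailCov_zero_left (p q : ℝ) (m b : ℕ) : tailCov p q m 0 b = 0 := by
  simp [tailCov, jointTail_zero_left]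

lemma tailCov_zero_right (p q : ℝ) (m a : ℕ) : tailCov p q m a 0 = 0 := by
  simp [tailCov, jointTail_zero_right]

/-- The covariance starts at zero. Each of the m steps adds a source of size at most e p q times the
product of envelopes, and `envelope_joint_step` carries earlier sources forward without
amplification. -/
lemma abs_tailCov_le {p q : ℝ} (hp : 0 ≤ p) (hq : 0 ≤ q) (hpq : p + q ≤ 1) (m a b : ℕ) :
    |tailCov p q m (a + 1) (b + 1)|
      ≤ m * Real.exp 1 * (p * q) * (envelope p m a * envelope q m b) := by
  induction m generalizing a b with
  | zero => simp [tailCov, jointTail, binTail]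
  | succ m ih =>
    have hp1 : p ≤ 1 := by linarith
    have hq1 : q ≤ 1 := by linarith
    have hr : 0 ≤ 1 - p - q := by linarith
    have hK : 0 ≤ m * Real.exp 1 * (p * q) := by positivity
    have nA := fun i => envelope_nonneg hp m i
    have nB := fun i => envelope_nonneg hq m i
    -- At `a = 0` the event is certain and the covariance vanishes, which matches the `if` in
    -- `envelope_joint_step`.
    have h1 : |tailCov p q m a (b + 1)| ≤ m * Real.exp 1 * (p * q) *
        (if a = 0 then 0 else envelope p m (a - 1) * envelope q m b) := by
      cases a with
      | zero => simp [tailCov_zero_left]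
      | succ a => simpa using ih a b
    have h2 : |tailCov p q m (a + 1) b| ≤ m * Real.exp 1 * (p * q) *
        (if b = 0 then 0 else envelope p m a * envelope q m (b - 1)) := by
      cases b with
      | zero => simp [tailCov_zero_right]
      | succ b => simpa using ih a b
    have h3 := ih a b
    have hd : |(binTail p m a - binTail p m (a + 1)) * (binTail q m b - binTail q m (b + 1))|
        ≤ Real.exp 1 * (envelope p (m + 1) a * envelope q (m + 1) b) := by
      rw [abs_of_nonneg (mul_nonneg (binTail_sub_nonneg hp hp1 _ _)
        (binTail_sub_nonneg hq hq1 _ _))]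
      calc _ ≤ (Real.exp p * envelope p (m + 1) a) * (Real.exp q * envelope q (m + 1) b) :=
            mul_le_mul ((binTail_sub_le_envelope hp hp1 _ _).trans (envelope_shift hp _ _))
              ((binTail_sub_le_envelope hq hq1 _ _).trans (envelope_shift hq _ _))
              (binTail_sub_nonneg hq hq1 _ _)
              (mul_nonneg (Real.exp_pos _).le (envelope_nonneg hp _ _))
        _ = Real.exp (p + q) * (envelope p (m + 1) a * envelope q (m + 1) b) := by
            rw [Real.exp_add]; ring
        _ ≤ _ := mul_le_mul_of_nonneg_right (Real.exp_le_exp.2 hpq)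
            (mul_nonneg (envelope_nonneg hp _ _) (envelope_nonneg hq _ _))
    have hstep := envelope_joint_step hp hq hpq m a b
    rw [tailCov_succ, Nat.add_sub_cancel, Nat.add_sub_cancel]
    set D := envelope p (m + 1) a * envelope q (m + 1) b with hD
    have t1 := mul_le_mul_of_nonneg_left h1 hp
    have t2 := mul_le_mul_of_nonneg_left h2 hq
    have t3 := mul_le_mul_of_nonneg_left h3 hr
    have t4 := mul_le_mul_of_nonneg_left hd (mul_nonneg hp hq)
    have t5 := mul_le_mul_of_nonneg_left hstep hK
    have e1 : p * (if a = 0 then (0 : ℝ) else envelope p m (a - 1) * envelope q m b)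
      = if a = 0 then 0 else p * (envelope p m (a - 1) * envelope q m b) := by
      split_ifs <;> ring
    have e2 : q * (if b = 0 then (0 : ℝ) else envelope p m a * envelope q m (b - 1))
      = if b = 0 then 0 else q * (envelope p m a * envelope q m (b - 1)) := by
      split_ifs <;> ring
    rw [← e1, ← e2] at t5
    calc _ ≤ |p * tailCov p q m a (b + 1)| + |q * tailCov p q m (a + 1) b|
          + |(1 - p - q) * tailCov p q m (a + 1) (b + 1)|
          + |p * q * ((binTail p m a - binTail p m (a + 1)) *
              (binTail q m b - binTail q m (b + 1)))| :=
          (abs_sub _ _).trans (add_le_add ((abs_add_le _ _).trans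
            (add_le_add (abs_add_le _ _) le_rfl)) le_rfl)
      _ = p * |tailCov p q m a (b + 1)| + q * |tailCov p q m (a + 1) b|
          + (1 - p - q) * |tailCov p q m (a + 1) (b + 1)|
          + p * q * |(binTail p m a - binTail p m (a + 1)) *
              (binTail q m b - binTail q m (b + 1))| := by
          rw [abs_mul, abs_mul q, abs_mul (1 - p - q), abs_mul (p * q), abs_of_nonneg hp,
            abs_of_nonneg hq, abs_of_nonneg hr, abs_of_nonneg (mul_nonneg hp hq)]
      _ ≤ m * Real.exp 1 * (p * q) * D + p * q * (Real.exp 1 * D) := by linarith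
      _ = _ := by push_cast; ring

/-! ### Poisson approximation of binomial tails -/

lemma poissonMass_nonneg {x : ℝ} (hx : 0 ≤ x) (a : ℕ) : 0 ≤ poissonMass x a := by
  unfold poissonMass; positivity

lemma hasDerivAt_poissonMass_zero (x : ℝ) :
    HasDerivAt (fun y => poissonMass y 0) (-poissonMass x 0) x := by
  simp only [poissonMass, pow_zero, Nat.factorial_zero, Nat.cast_one, div_one, mul_one]
  simpa using (hasDerivAt_neg x).exp

lemma hasDerivAt_poissonMass_succ (x : ℝ) (a : ℕ) :
    HasDerivAt (fun y => poissonMass y (a + 1)) (poissonMass x a - poissonMass x (a + 1)) x := by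
  have h := (((hasDerivAt_neg x).exp).mul (hasDerivAt_pow (a + 1) x)).div_const
    ((a + 1).factorial : ℝ)
  refine h.congr_deriv ?_
  simp only [poissonMass, Nat.factorial_succ, Nat.add_sub_cancel]
  push_cast
  have : (a.factorial : ℝ) ≠ 0 := by positivity
  have : (a + 1 : ℝ) ≠ 0 := by positivity
  field_simp
  ring

lemma hasDerivAt_poissonTail_succ (x : ℝ) (a : ℕ) :
    HasDerivAt (fun y => poissonTail y (a + 1)) (poissonMass x a) x := by
  induction a with
  | zero =>
    simp only [poissonTail_succ, poissonTail_zero]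
    simpa using (hasDerivAt_poissonMass_zero x).const_sub 1
  | succ a ih =>
    simp only [poissonTail_succ _ (a + 1)]
    exact (ih.sub (hasDerivAt_poissonMass_succ x a)).congr_deriv (by ring)

/-- The bound on the derivative of `poissonMass` used in the Taylor estimate. -/
def envelopePair (p : ℝ) (m a : ℕ) : ℝ :=
  envelope p m a + if a = 0 then 0 else envelope p m (a - 1)

lemma envelopePair_nonneg {p : ℝ} (hp : 0 ≤ p) (m a : ℕ) : 0 ≤ envelopePair p m a := by
  have := envelope_nonneg hp m a
  have := envelope_nonneg hp m (a - 1)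
  unfold envelopePair; split_ifs <;> linarith

/-- The prefactor e compensates for y ≥ m p rather than y ≥ (m + 1) p in the exponential; the
enlarged base of the power absorbs y ≤ (m + 1) p. -/
lemma poissonMass_le_envelope {p : ℝ} (hp : 0 ≤ p) (hp1 : p ≤ 1) {m : ℕ} {y : ℝ}
    (hy : y ∈ Set.Icc (m * p) (m * p + p)) (a : ℕ) :
    poissonMass y a ≤ Real.exp 1 * envelope p (m + 1) a := by
  have hy0 : 0 ≤ y := le_trans (by positivity) hy.1
  have h1 : Real.exp (-y) ≤ Real.exp 1 * Real.exp (-((m + 1 : ℕ) * p)) := by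
    rw [← Real.exp_add]
    refine Real.exp_le_exp.2 ?_
    have := hy.1
    push_cast; nlinarith
  have h2 : y ≤ (m + 1 : ℕ) * (Real.exp 1 * p) := by
    have h3 : p ≤ Real.exp 1 * p := by
      have := Real.one_le_exp (zero_le_one (α := ℝ)); nlinarith
    have h4 : (m + 1) * p ≤ (m + 1) * (Real.exp 1 * p) := by gcongr
    have := hy.2
    push_cast; linarith
  unfold poissonMass envelope
  calc Real.exp (-y) * y ^ a / a.factorial
      ≤ (Real.exp 1 * Real.exp (-((m + 1 : ℕ) * p))) * ((m + 1 : ℕ) * (Real.exp 1 * p)) ^ a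
        / a.factorial := by gcongr
    _ = _ := by ring

/-- Mean value inequality for f minus its linear part at x. -/
lemma abs_taylor_le {f f' : ℝ → ℝ} {x p M : ℝ} (hp : 0 ≤ p)
    (hf : ∀ y, HasDerivAt f (f' y) y)
    (hM : ∀ y ∈ Set.Icc x (x + p), |f' y - f' x| ≤ M) :
    |f (x + p) - f x - p * f' x| ≤ M * p := by
  have h := (convex_Icc x (x + p)).norm_image_sub_le_of_norm_hasDerivWithin_le
    (f := fun y => f y - f' x * y) (f' := fun y => f' y - f' x) (C := M)
    (fun y _ => (((hf y).sub ((hasDerivAt_id y).const_mul (f' x))).congr_deriv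
      (by simp)).hasDerivWithinAt)
    (fun y hy => hM y hy) (Set.left_mem_Icc.2 (by linarith)) (Set.right_mem_Icc.2 (by linarith))
  have e : f (x + p) - f' x * (x + p) - (f x - f' x * x) = f (x + p) - f x - p * f' x := by ring
  simpa [Real.norm_eq_abs, e, abs_of_nonneg hp] using h

lemma abs_poissonMass_sub_le {p : ℝ} (hp : 0 ≤ p) (hp1 : p ≤ 1) {m : ℕ} (a : ℕ) {y : ℝ}
    (hy : y ∈ Set.Icc (m * p) (m * p + p)) :
    |poissonMass y a - poissonMass (m * p) a|
      ≤ Real.exp 1 * envelopePair p (m + 1) a * p := by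
  have hC : 0 ≤ Real.exp 1 * envelopePair p (m + 1) a :=
    mul_nonneg (Real.exp_pos _).le (envelopePair_nonneg hp _ _)
  have key : ‖poissonMass y a - poissonMass (m * p) a‖
      ≤ Real.exp 1 * envelopePair p (m + 1) a * ‖y - m * p‖ := by
    have hl : (m * p : ℝ) ∈ Set.Icc (m * p : ℝ) (m * p + p) := Set.left_mem_Icc.2 (by linarith)
    have hz0 : ∀ z ∈ Set.Icc (m * p : ℝ) (m * p + p), 0 ≤ z :=
      fun z hz => le_trans (by positivity) hz.1
    cases a with
    | zero =>
      refine (convex_Icc _ _).norm_image_sub_le_of_norm_hasDerivWithin_le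
        (f := fun y => poissonMass y 0) (f' := fun y => -poissonMass y 0)
        (fun z _ => (hasDerivAt_poissonMass_zero z).hasDerivWithinAt) (fun z hz => ?_) hl hy
      rw [norm_neg, Real.norm_eq_abs, abs_of_nonneg (poissonMass_nonneg (hz0 z hz) _)]
      simpa [envelopePair] using poissonMass_le_envelope hp hp1 hz 0
    | succ a =>
      refine (convex_Icc _ _).norm_image_sub_le_of_norm_hasDerivWithin_le
        (f := fun y => poissonMass y (a + 1))
        (f' := fun y => poissonMass y a - poissonMass y (a + 1))
        (fun z _ => (hasDerivAt_poissonMass_succ z a).hasDerivWithinAt) (fun z hz => ?_) hl hy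
      have n1 := poissonMass_nonneg (hz0 z hz) a
      have n2 := poissonMass_nonneg (hz0 z hz) (a + 1)
      have b1 := poissonMass_le_envelope hp hp1 hz a
      have b2 := poissonMass_le_envelope hp hp1 hz (a + 1)
      simp only [envelopePair, Nat.add_sub_cancel, if_neg (Nat.succ_ne_zero a)]
      rw [Real.norm_eq_abs, abs_le]
      constructor <;> linarith
  refine key.trans (mul_le_mul_of_nonneg_left ?_ hC)
  rw [Real.norm_eq_abs, abs_of_nonneg (by linarith [hy.1])]
  linarith [hy.2]

lemma envelopePair_step {p : ℝ} (hp : 0 ≤ p) (hp1 : p ≤ 1) (m a : ℕ) :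
    p * (if a = 0 then 0 else envelopePair p m (a - 1)) + (1 - p) * envelopePair p m a
      ≤ envelopePair p (m + 1) a := by
  rcases a with _ | _ | a
  · simpa [envelopePair] using envelope_step_zero m
  · have h1 := envelope_step hp hp1 m 0
    have h2 := envelope_step_zero (p := p) m
    simp only [envelopePair, zero_add, one_ne_zero, if_false, Nat.sub_self, if_true, add_zero]
      at h1 ⊢
    linarith
  · have h1 := envelope_step hp hp1 m (a + 1)
    have h2 := envelope_step hp hp1 m a
    simp only [envelopePair, Nat.succ_ne_zero, if_false, Nat.add_sub_cancel]
    linarith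

/-- In m, the binomial tails are the Euler scheme with step p for the differential equations of the
Poisson tails. The local Taylor error is at most e p² times `envelopePair`, and `envelopePair_step`
prevents amplification over the m steps. -/
lemma abs_binTail_sub_poissonTail_le {p : ℝ} (hp : 0 ≤ p) (hp1 : p ≤ 1) (m a : ℕ) :
    |binTail p m (a + 1) - poissonTail (m * p) (a + 1)|
      ≤ m * Real.exp 1 * p ^ 2 * envelopePair p m a := by
  induction m generalizing a with
  | zero =>
    have : poissonTail 0 (a + 1) = 0 := by
      rw [poissonTail, Finset.sum_range_succ']
      simp [poissonMass]
    simp [binTail, this]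
  | succ m ih =>
    have hr : 0 ≤ 1 - p := by linarith
    have hK : 0 ≤ m * Real.exp 1 * p ^ 2 := by positivity
    have h1 : |binTail p m a - poissonTail (m * p) a| ≤ m * Real.exp 1 * p ^ 2 *
        (if a = 0 then 0 else envelopePair p m (a - 1)) := by
      cases a with
      | zero => simp
      | succ a => simpa using ih a
    have h2 := ih a
    have h3 := abs_taylor_le (x := m * p) (M := Real.exp 1 * envelopePair p (m + 1) a * p) hp
      (fun y => hasDerivAt_poissonTail_succ y a)
      (fun y hy => abs_poissonMass_sub_le hp hp1 a hy)
    have hstep := mul_le_mul_of_nonneg_left (envelopePair_step hp hp1 m a) hK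
    have t1 := mul_le_mul_of_nonneg_left h1 hp
    have t2 := mul_le_mul_of_nonneg_left h2 hr
    have hm : poissonMass (m * p) a = poissonTail (m * p) a - poissonTail (m * p) (a + 1) := by
      rw [poissonTail_succ]; ring
    have e : binTail p (m + 1) (a + 1) - poissonTail ((m + 1 : ℕ) * p) (a + 1)
        = p * (binTail p m a - poissonTail (m * p) a)
          + (1 - p) * (binTail p m (a + 1) - poissonTail (m * p) (a + 1))
          - (poissonTail (m * p + p) (a + 1) - poissonTail (m * p) (a + 1)
              - p * poissonMass (m * p) a) := by
      rw [show ((m + 1 : ℕ) : ℝ) * p = m * p + p by push_cast; ring]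
      simp only [binTail, Nat.add_sub_cancel]
      rw [hm]; ring
    rw [e]
    calc _ ≤ |p * (binTail p m a - poissonTail (m * p) a)|
          + |(1 - p) * (binTail p m (a + 1) - poissonTail (m * p) (a + 1))|
          + |poissonTail (m * p + p) (a + 1) - poissonTail (m * p) (a + 1)
              - p * poissonMass (m * p) a| :=
          (abs_sub _ _).trans (add_le_add (abs_add_le _ _) le_rfl)
      _ ≤ _ := by
          rw [abs_mul, abs_mul, abs_of_nonneg hp, abs_of_nonneg hr]
          push_cast
          linarith

/-! ### Poissonization of binomial tails -/

lemma hasSum_poissonMass (t : ℝ) : HasSum (poissonMass t) 1 := by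
  have h := (NormedSpace.expSeries_div_hasSum_exp (𝔸 := ℝ) t).mul_left (Real.exp (-t))
  rw [← Real.exp_eq_exp_ℝ, ← Real.exp_add, neg_add_cancel, Real.exp_zero] at h
  refine h.congr_fun fun n => ?_
  simp only [poissonMass]; ring

/-- The terms below c vanish; shifting the index by c leaves the exponential series of t r. -/
lemma hasSum_poissonMass_choose (t r : ℝ) (c : ℕ) :
    HasSum (fun m => poissonMass t m * (m.choose c * r ^ (m - c)))
      (t ^ c / c.factorial * Real.exp (t * r - t)) := by
  have h := (NormedSpace.expSeries_div_hasSum_exp (𝔸 := ℝ) (t * r)).mul_left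
    (Real.exp (-t) * (t ^ c / c.factorial))
  rw [← Real.exp_eq_exp_ℝ] at h
  have e : Real.exp (-t) * (t ^ c / c.factorial) * Real.exp (t * r)
      = t ^ c / c.factorial * Real.exp (t * r - t) := by
    rw [sub_eq_add_neg, Real.exp_add]; ring
  rw [e] at h
  have hz : ∑ i ∈ Finset.range c, poissonMass t i * (i.choose c * r ^ (i - c)) = 0 :=
    Finset.sum_eq_zero fun i hi => by
      simp [Nat.choose_eq_zero_of_lt (Finset.mem_range.1 hi)]
  rw [← hasSum_nat_add_iff' c, hz, sub_zero]
  refine h.congr_fun fun n => ?_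
  have hc : ((n + c).choose c : ℝ) * (n.factorial * c.factorial) = (n + c).factorial := by
    rw [← Nat.add_choose_mul_factorial_mul_factorial]; push_cast; ring
  simp only [poissonMass, Nat.add_sub_cancel]
  rw [← hc]
  have h1 : (n.factorial : ℝ) ≠ 0 := by positivity
  have h2 : (c.factorial : ℝ) ≠ 0 := by positivity
  have h3 : ((n + c).choose c : ℝ) ≠ 0 := by
    exact_mod_cast (Nat.choose_pos (Nat.le_add_left c n)).ne'
  field_simp
  ring

lemma hasSum_poissonMass_binTail (t p : ℝ) (a : ℕ) :
    HasSum (fun m => poissonMass t m * binTail p m a) (poissonTail (t * p) a) := by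
  induction a with
  | zero => simpa using hasSum_poissonMass t
  | succ a ih =>
    have h := (hasSum_poissonMass_choose t (1 - p) a).mul_left (p ^ a)
    have h' := ih.sub h
    have e : poissonTail (t * p) a - p ^ a * (t ^ a / a.factorial * Real.exp (t * (1 - p) - t))
        = poissonTail (t * p) (a + 1) := by
      rw [poissonTail_succ, poissonMass, show t * (1 - p) - t = -(t * p) by ring, mul_pow]; ring
    rw [e] at h'
    refine h'.congr_fun fun m => ?_
    have := binTail_sub_succ p m a
    linear_combination -poissonMass t m * this

/-- The product form on the right expresses independence of two boxes after Poissonization. The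
second difference reduces the double induction to point masses, where the exponential factorizes. -/
lemma hasSum_poissonMass_jointTail (t p q : ℝ) (a b : ℕ) :
    HasSum (fun m => poissonMass t m * jointTail p q m a b)
      (poissonTail (t * p) a * poissonTail (t * q) b) := by
  induction a generalizing b with
  | zero => simpa [jointTail_zero_left] using hasSum_poissonMass_binTail t q b
  | succ a iha =>
    induction b with
    | zero => simpa [jointTail_zero_right] using hasSum_poissonMass_binTail t p (a + 1)
    | succ b ihb =>
      have h := (hasSum_poissonMass_choose t (1 - p - q) (a + b)).mul_left
        ((a + b).choose a * p ^ a * q ^ b)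
      have h' := ((h.add ihb).add (iha (b + 1))).sub (iha b)
      have hc : ((a + b).choose a : ℝ) * (a.factorial * b.factorial) = (a + b).factorial := by
        rw [add_comm a b, ← Nat.add_choose_mul_factorial_mul_factorial]; push_cast; ring
      have e : (a + b).choose a * p ^ a * q ^ b *
            (t ^ (a + b) / (a + b).factorial * Real.exp (t * (1 - p - q) - t))
          = poissonMass (t * p) a * poissonMass (t * q) b := by
        rw [show t * (1 - p - q) - t = -(t * p) + -(t * q) by ring, Real.exp_add, ← hc]
        have h1 : (a.factorial : ℝ) ≠ 0 := by positivity
        have h2 : (b.factorial : ℝ) ≠ 0 := by positivity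
        have h3 : ((a + b).choose a : ℝ) ≠ 0 := by
          exact_mod_cast (Nat.choose_pos (Nat.le_add_right a b)).ne'
        simp only [poissonMass]
        field_simp
        ring
      have e' : poissonTail (t * p) (a + 1) * poissonTail (t * q) (b + 1)
          = (a + b).choose a * p ^ a * q ^ b *
            (t ^ (a + b) / (a + b).factorial * Real.exp (t * (1 - p - q) - t))
            + poissonTail (t * p) (a + 1) * poissonTail (t * q) b
            + poissonTail (t * p) a * poissonTail (t * q) (b + 1)
            - poissonTail (t * p) a * poissonTail (t * q) b := by
        rw [e, poissonTail_succ, poissonTail_succ]; ring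
      rw [e']
      refine h'.congr_fun fun m => ?_
      have := jointTail_second_diff p q m a b
      linear_combination poissonMass t m * this

/-! ### Box counts and variances as double sums -/

/-- The number of balls among the first `m` that fall into box `k`. -/
def boxCount {Ω : Type*} (X : ℕ → Ω → ℕ) (m k : ℕ) (ω : Ω) : ℕ :=
  ((Finset.range m).filter fun i => X i ω = k).card

lemma ncard_eq_boxCount {Ω : Type*} (X : ℕ → Ω → ℕ) (m k : ℕ) (ω : Ω) :
    {i : ℕ | i < m ∧ X i ω = k}.ncard = boxCount X m k ω := by
  rw [boxCount, ← Set.ncard_coe_finset]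
  congr 1
  ext i; simp

lemma boxCount_succ {Ω : Type*} (X : ℕ → Ω → ℕ) (m k : ℕ) (ω : Ω) :
    boxCount X (m + 1) k ω = boxCount X m k ω + if X m ω = k then 1 else 0 := by
  unfold boxCount
  rw [Finset.range_add_one, Finset.filter_insert]
  split_ifs with h
  · rw [Finset.card_insert_of_notMem (by simp)]
  · simp

/-- With `j ≥ 1` a counted box has been hit, so only finitely many are counted; for `j = 0` every
box would qualify. -/
lemma setOf_le_boxCount_subset {Ω : Type*} (X : ℕ → Ω → ℕ) (m : ℕ) (ω : Ω) {j : ℕ} (hj : 1 ≤ j) :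
    {k | j ≤ boxCount X m k ω} ⊆ ((Finset.range m).image fun i => X i ω : Finset ℕ) := by
  intro k hk
  have hk' : j ≤ boxCount X m k ω := hk
  have : 0 < ((Finset.range m).filter fun i => X i ω = k).card := lt_of_lt_of_le hj hk'
  obtain ⟨i, hi⟩ := Finset.card_pos.1 this
  rw [Finset.mem_filter] at hi
  exact Finset.mem_coe.2 (Finset.mem_image.2 ⟨i, hi.1, hi.2⟩)

lemma detCount_eq {Ω : Type*} (X : ℕ → Ω → ℕ) (j m : ℕ) (ω : Ω) :
    detCount X j m ω = ({k | j ≤ boxCount X m k ω}.ncard : ℝ) := by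
  simp only [detCount, ncard_eq_boxCount]

lemma detCount_le {Ω : Type*} (X : ℕ → Ω → ℕ) (m : ℕ) (ω : Ω) {j : ℕ} (hj : 1 ≤ j) :
    detCount X j m ω ≤ m := by
  rw [detCount_eq]
  have h := Set.ncard_le_ncard (setOf_le_boxCount_subset X m ω hj) (Finset.finite_toSet _)
  rw [Set.ncard_coe_finset] at h
  exact_mod_cast h.trans (Finset.card_image_le.trans (by simp))

lemma detCount_nonneg {Ω : Type*} (X : ℕ → Ω → ℕ) (j m : ℕ) (ω : Ω) : 0 ≤ detCount X j m ω :=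
  Nat.cast_nonneg _

/-- The cardinality of a finite set of indices is the sum of the indicators. -/
lemma hasSum_indicator_ncard {Ω : Type*} {A : ℕ → Set Ω} {ω : Ω} (h : {k | ω ∈ A k}.Finite) :
    HasSum (fun k => (A k).indicator (fun _ => (1 : ℝ)) ω) ({k | ω ∈ A k}.ncard : ℝ) := by
  classical
  have h1 : ∀ k ∉ h.toFinset, (A k).indicator (fun _ => (1 : ℝ)) ω = 0 := by
    intro k hk
    exact Set.indicator_of_notMem (by simpa using hk) _
  have h2 : HasSum (fun k => (A k).indicator (fun _ => (1 : ℝ)) ω) _ :=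
    hasSum_sum_of_ne_finset_zero h1
  have h3 : ∑ k ∈ h.toFinset, (A k).indicator (fun _ => (1 : ℝ)) ω
      = ({k | ω ∈ A k}.ncard : ℝ) := by
    rw [Finset.sum_congr rfl (g := fun _ => (1 : ℝ)), Set.ncard_eq_toFinset_card _ h]
    · simp
    · intro k hk
      exact Set.indicator_of_mem (by simpa using hk) _
  rwa [h3] at h2

lemma hasSum_mul_self_of_nonneg {f : ℕ → ℝ} {s : ℝ} (hf : HasSum f s) (h0 : ∀ k, 0 ≤ f k) :
    HasSum (fun c : ℕ × ℕ => f c.1 * f c.2) (s * s) :=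
  hf.mul hf (hf.summable.mul_of_nonneg hf.summable h0 h0)

section Probability

variable {Ω : Type*} [MeasurableSpace Ω] {P : Measure Ω}

/-- Term-by-term integration of a sum of indicators. -/
lemma hasSum_measureReal_of_indicator {ι : Type*} [Countable ι] {B : ι → Set Ω} {W : Ω → ℝ}
    (hB : ∀ i, MeasurableSet (B i)) (hW : Integrable W P)
    (h : ∀ᵐ ω ∂P, HasSum (fun i => (B i).indicator (fun _ => (1 : ℝ)) ω) (W ω)) :
    HasSum (fun i => P.real (B i)) (∫ ω, W ω ∂P) := by
  have h' := hasSum_integral_of_dominated_convergence (μ := P)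
    (F := fun i ω => (B i).indicator (fun _ => (1 : ℝ)) ω) (f := W)
    (fun i ω => (B i).indicator (fun _ => (1 : ℝ)) ω)
    (fun i => ((measurable_const.indicator (hB i)).aestronglyMeasurable))
    (fun i => Eventually.of_forall fun ω => by
      rw [Real.norm_eq_abs, abs_of_nonneg]
      exact Set.indicator_nonneg (fun _ _ => zero_le_one) _)
    (h.mono fun ω hω => hω.summable)
    (hW.congr (h.mono fun ω hω => hω.tsum_eq.symm)) h
  refine h'.congr_fun fun i => ?_
  simp [integral_indicator_const _ (hB i)]

/-- The variance of the number of events that occur is the sum of all the covariances. -/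
lemma hasSum_variance_ncard [IsProbabilityMeasure P] {A : ℕ → Set Ω} {Z : Ω → ℝ} (hA : ∀ k, MeasurableSet (A k))
    (hZ : ∀ᵐ ω ∂P, {k | ω ∈ A k}.Finite ∧ Z ω = ({k | ω ∈ A k}.ncard : ℝ))
    (hL : MemLp Z 2 P) :
    HasSum (fun c : ℕ × ℕ => P.real (A c.1 ∩ A c.2) - P.real (A c.1) * P.real (A c.2))
      (variance Z P) := by
  have h1 : ∀ᵐ ω ∂P, HasSum (fun k => (A k).indicator (fun _ => (1 : ℝ)) ω) (Z ω) :=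
    hZ.mono fun ω hω => hω.2 ▸ hasSum_indicator_ncard hω.1
  have s1 := hasSum_measureReal_of_indicator hA (hL.integrable (by norm_num)) h1
  have s2 : HasSum (fun c : ℕ × ℕ => P.real (A c.1 ∩ A c.2)) (∫ ω, Z ω ^ 2 ∂P) := by
    refine hasSum_measureReal_of_indicator (fun c => (hA _).inter (hA _)) hL.integrable_sq ?_
    refine h1.mono fun ω hω => ?_
    have := hasSum_mul_self_of_nonneg hω
      (fun k => Set.indicator_nonneg (fun _ _ => zero_le_one) _)
    rw [sq]
    refine this.congr_fun fun c => ?_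
    by_cases h1 : ω ∈ A c.1 <;> by_cases h2 : ω ∈ A c.2 <;> simp [h1, h2]
  have s3 := hasSum_mul_self_of_nonneg s1 (fun k => measureReal_nonneg)
  have e : variance Z P = ∫ ω, Z ω ^ 2 ∂P - (∫ ω, Z ω ∂P) * ∫ ω, Z ω ∂P := by
    rw [variance_eq_sub hL, sq (∫ ω, Z ω ∂P)]
    rfl
  rw [e]
  exact s2.sub s3

/-! ### Laws of the box counts in the deterministic scheme -/

variable {p : ℕ → ℝ} {X : ℕ → Ω → ℕ} {ξ : ℕ → Ω → ℝ}

lemma measurable_boxCount (hX : ∀ m, Measurable (X m)) (m k : ℕ) : Measurable (boxCount X m k) := by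
  induction m with
  | zero =>
    have : boxCount X 0 k = fun _ => 0 := by ext; simp [boxCount]
    rw [this]
    exact measurable_const
  | succ m ih =>
    simp only [funext (boxCount_succ X m k)]
    exact ih.add (Measurable.ite (hX m (measurableSet_singleton k)) measurable_const
      measurable_const)

lemma measurableSet_le_boxCount (hX : ∀ m, Measurable (X m)) (m k a : ℕ) :
    MeasurableSet {ω | a ≤ boxCount X m k ω} :=
  measurableSet_le measurable_const (measurable_boxCount hX m k)

lemma indepFun_boxCount_pair (h : IsScheme P p X ξ) (m k l : ℕ) :
    IndepFun (fun ω => (boxCount X m k ω, boxCount X m l ω)) (X m) P := by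
  classical
  have h1 := h.indep_box.indepFun_finset (Finset.range m) {m} (by simp) h.measurable_box
  let c : ℕ → (↥(Finset.range m) → ℕ) → ℕ := fun k x => (Finset.univ.filter fun i => x i = k).card
  have hc : ∀ k, Measurable (c k) := fun k => Measurable.of_discrete
  have e : ∀ k ω, c k (fun i => X i ω) = boxCount X m k ω := by
    intro k ω
    simp only [c, boxCount]
    rw [← Finset.card_map (Function.Embedding.subtype _)]
    congr 1
    ext i; simp
    tauto
  have h2 := h1.comp (φ := fun x => (c k x, c l x))
    (ψ := fun y : ↥({m} : Finset ℕ) → ℕ => y ⟨m, by simp⟩) ((hc k).prodMk (hc l))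
    Measurable.of_discrete
  have e' : (fun ω => (boxCount X m k ω, boxCount X m l ω))
      = (fun x => (c k x, c l x)) ∘ fun ω (i : ↥(Finset.range m)) => X i ω := by
    ext ω : 1
    simp [e]
  rw [e']
  exact h2

lemma measureReal_boxCount_inter (h : IsScheme P p X ξ) (m k l a b : ℕ) (s : Set ℕ) :
    P.real ({ω | a ≤ boxCount X m k ω ∧ b ≤ boxCount X m l ω} ∩ {ω | X m ω ∈ s})
      = P.real {ω | a ≤ boxCount X m k ω ∧ b ≤ boxCount X m l ω} * P.real {ω | X m ω ∈ s} := by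
  have := (indepFun_boxCount_pair h m k l).measure_inter_preimage_eq_mul
    {c : ℕ × ℕ | a ≤ c.1 ∧ b ≤ c.2} s (MeasurableSet.of_discrete) (MeasurableSet.of_discrete)
  simp only [measureReal_def, ← ENNReal.toReal_mul]
  exact congrArg ENNReal.toReal this

/-- Splitting according to whether the last ball hits k, l or neither reproduces the recursion of
`jointTail`. Truncated `a - 1` is harmless: `a ≤ N + 1 ↔ a - 1 ≤ N` also holds at `a = 0`. -/
lemma measureReal_pair_boxCount [IsProbabilityMeasure P] (h : IsScheme P p X ξ) {k l : ℕ} (hkl : k ≠ l) (m a b : ℕ) :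
    P.real {ω | a ≤ boxCount X m k ω ∧ b ≤ boxCount X m l ω} = jointTail (p k) (p l) m a b := by
  induction m generalizing a b with
  | zero =>
    by_cases hab : a = 0 ∧ b = 0
    · simp [jointTail, hab]
    · simp [jointTail, hab, boxCount]
  | succ m ih =>
    have hX := h.measurable_box
    have mk : MeasurableSet {ω | X m ω ∈ ({k} : Set ℕ)} := hX m (MeasurableSet.of_discrete)
    have ml : MeasurableSet {ω | X m ω ∈ ({l} : Set ℕ)} := hX m (MeasurableSet.of_discrete)
    have pk : P.real {ω | X m ω ∈ ({k} : Set ℕ)} = p k := by simpa using h.law_box m k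
    have pl : P.real {ω | X m ω ∈ ({l} : Set ℕ)} = p l := by simpa using h.law_box m l
    have dkl : Disjoint {ω | X m ω ∈ ({k} : Set ℕ)} {ω | X m ω ∈ ({l} : Set ℕ)} := by
      rw [Set.disjoint_left]
      intro ω h1 h2
      exact hkl (h1.symm.trans h2)
    have po : P.real {ω | X m ω ∈ ({k, l}ᶜ : Set ℕ)} = 1 - p k - p l := by
      have e : {ω | X m ω ∈ ({k, l}ᶜ : Set ℕ)}
          = ({ω | X m ω ∈ ({k} : Set ℕ)} ∪ {ω | X m ω ∈ ({l} : Set ℕ)})ᶜ := by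
        ext ω; simp
      rw [e, probReal_compl_eq_one_sub (mk.union ml), measureReal_union dkl ml, pk, pl]; ring
    set S := {ω | a ≤ boxCount X (m + 1) k ω ∧ b ≤ boxCount X (m + 1) l ω} with hS
    have mS : MeasurableSet S := (measurableSet_le_boxCount hX _ _ _).inter
      (measurableSet_le_boxCount hX _ _ _)
    have e1 : S ∩ {ω | X m ω ∈ ({k} : Set ℕ)}
        = {ω | a - 1 ≤ boxCount X m k ω ∧ b ≤ boxCount X m l ω} ∩
          {ω | X m ω ∈ ({k} : Set ℕ)} := by
      ext ω
      simp only [hS, Set.mem_inter_iff, Set.mem_ofPred_eq, Set.mem_singleton_iff, boxCount_succ]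
      refine and_congr_left fun hk => ?_
      rw [if_pos hk, if_neg (by omega)]
      omega
    have e2 : (S \ {ω | X m ω ∈ ({k} : Set ℕ)}) ∩ {ω | X m ω ∈ ({l} : Set ℕ)}
        = {ω | a ≤ boxCount X m k ω ∧ b - 1 ≤ boxCount X m l ω} ∩
          {ω | X m ω ∈ ({l} : Set ℕ)} := by
      ext ω
      simp only [hS, Set.mem_inter_iff, Set.mem_sdiff, Set.mem_ofPred_eq, Set.mem_singleton_iff,
        boxCount_succ]
      refine and_congr_left fun hl => ?_
      rw [if_pos hl, if_neg (by omega)]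
      omega
    have e3 : (S \ {ω | X m ω ∈ ({k} : Set ℕ)}) \ {ω | X m ω ∈ ({l} : Set ℕ)}
        = {ω | a ≤ boxCount X m k ω ∧ b ≤ boxCount X m l ω} ∩
          {ω | X m ω ∈ ({k, l}ᶜ : Set ℕ)} := by
      ext ω
      simp only [hS, Set.mem_inter_iff, Set.mem_sdiff, Set.mem_ofPred_eq, Set.mem_singleton_iff,
        boxCount_succ, Set.mem_compl_iff, Set.mem_insert_iff, not_or, and_assoc]
      constructor
      · rintro ⟨h1, h2, h3, h4⟩
        rw [if_neg h3] at h1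
        rw [if_neg h4] at h2
        exact ⟨h1, h2, h3, h4⟩
      · rintro ⟨h1, h2, h3, h4⟩
        rw [if_neg h3, if_neg h4]
        exact ⟨h1, h2, h3, h4⟩
    rw [← measureReal_inter_add_sdiff mk (s := S),
      ← measureReal_inter_add_sdiff ml (s := S \ {ω | X m ω ∈ ({k} : Set ℕ)}), e1, e2, e3,
      measureReal_boxCount_inter h, measureReal_boxCount_inter h, measureReal_boxCount_inter h,
      ih, ih, ih, pk, pl, po, jointTail]
    ring

/-- Pairing with box `k + 1` at threshold 0 makes the second condition void. -/
lemma measureReal_boxCount [IsProbabilityMeasure P] (h : IsScheme P p X ξ) (k m a : ℕ) :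
    P.real {ω | a ≤ boxCount X m k ω} = binTail (p k) m a := by
  have := measureReal_pair_boxCount h (Nat.succ_ne_self k).symm m a 0
  rw [jointTail_zero_right] at this
  simpa using this

lemma measurable_detCount (h : IsScheme P p X ξ) {j : ℕ} (hj : 1 ≤ j) (m : ℕ) :
    Measurable (detCount X j m) := by
  have h1 : ∀ ω, HasSum (fun k => ({ω | j ≤ boxCount X m k ω}).indicator (fun _ => (1 : ℝ)) ω)
      (detCount X j m ω) := by
    intro ω
    rw [detCount_eq]
    exact hasSum_indicator_ncard ((Finset.finite_toSet _).subset
      (setOf_le_boxCount_subset X m ω hj))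
  have h2 : detCount X j m
      = fun ω => ∑' k, ({ω | j ≤ boxCount X m k ω}).indicator (fun _ => (1 : ℝ)) ω :=
    funext fun ω => (h1 ω).tsum_eq.symm
  rw [h2]
  exact Measurable.tsum fun k =>
    measurable_const.indicator (measurableSet_le_boxCount h.measurable_box m k j)

lemma memLp_detCount [IsProbabilityMeasure P] (h : IsScheme P p X ξ) {j : ℕ} (hj : 1 ≤ j) (m : ℕ) :
    MemLp (detCount X j m) 2 P := by
  refine MemLp.of_bound (measurable_detCount h hj m).aestronglyMeasurable m
    (Eventually.of_forall fun ω => ?_)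
  rw [Real.norm_eq_abs, abs_of_nonneg (detCount_nonneg X j m ω)]
  exact detCount_le X m ω hj

/-- The variance of the deterministic count as a double sum. -/
lemma hasSum_variance_detCount [IsProbabilityMeasure P] (h : IsScheme P p X ξ) {j : ℕ} (hj : 1 ≤ j) (m : ℕ) :
    HasSum (fun c : ℕ × ℕ => if c.1 = c.2
        then binTail (p c.1) m j * (1 - binTail (p c.1) m j)
        else tailCov (p c.1) (p c.2) m j j)
      (variance (detCount X j m) P) := by
  have := hasSum_variance_ncard (P := P) (A := fun k => {ω | j ≤ boxCount X m k ω})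
    (fun k => measurableSet_le_boxCount h.measurable_box m k j)
    (Eventually.of_forall fun ω => ⟨(Finset.finite_toSet _).subset
      (setOf_le_boxCount_subset X m ω hj), detCount_eq X j m ω⟩) (memLp_detCount h hj m)
  refine this.congr_fun fun c => ?_
  split_ifs with hc
  · rw [hc, Set.inter_self, measureReal_boxCount h]; ring
  · rw [tailCov, ← measureReal_pair_boxCount h hc, ← measureReal_boxCount h,
      ← measureReal_boxCount h]
    rfl

end Probability

/-! ### The number of arrivals up to a fixed time -/

/-- An explicit primitive for the convolution of a Poisson tail with the exponential density. -/
lemma hasDerivAt_exp_neg_mul_poissonTail (t y : ℝ) (m : ℕ) :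
    HasDerivAt (fun y => -(Real.exp (-y) * poissonTail (t - y) (m + 1)))
      (Real.exp (-y) * poissonTail (t - y) m) y := by
  have h1 : HasDerivAt (fun y => Real.exp (-y)) (-Real.exp (-y)) y := by
    simpa using (hasDerivAt_neg y).exp
  have h2 : HasDerivAt (fun y => poissonTail (t - y) (m + 1)) (-poissonMass (t - y) m) y := by
    have := (hasDerivAt_poissonTail_succ (t - y) m).comp y ((hasDerivAt_id y).const_sub t)
    exact this.congr_deriv (by simp)
  refine (h1.mul h2).neg.congr_deriv ?_
  rw [poissonTail_succ]; ring

lemma poissonTail_zero_left (m : ℕ) : poissonTail 0 (m + 1) = 0 := by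
  rw [poissonTail, Finset.sum_range_succ']
  simp [poissonMass]

lemma continuous_poissonTail (m : ℕ) : Continuous fun x => poissonTail x m := by
  unfold poissonTail poissonMass
  fun_prop

lemma integral_exp_neg_mul_poissonTail {t : ℝ} (ht : 0 ≤ t) (m : ℕ) :
    ∫ y in Set.Icc 0 t, Real.exp (-y) * poissonTail (t - y) m = poissonTail t (m + 1) := by
  rw [integral_Icc_eq_integral_Ioc, ← intervalIntegral.integral_of_le ht,
    intervalIntegral.integral_eq_sub_of_hasDerivAt
      (fun y _ => hasDerivAt_exp_neg_mul_poissonTail t y m)]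
  · simp [poissonTail_zero_left]
  · have := continuous_poissonTail m
    exact Continuous.intervalIntegrable (by fun_prop) _ _

section Walk

variable {Ω : Type*} [MeasurableSpace Ω] {P : Measure Ω}
  {p : ℕ → ℝ} {X : ℕ → Ω → ℕ} {ξ : ℕ → Ω → ℝ}

/-- The random walk with increments `ξ`. -/
def walk {Ω : Type*} (ξ : ℕ → Ω → ℝ) (m : ℕ) (ω : Ω) : ℝ := ∑ i ∈ Finset.range m, ξ i ω

lemma walk_succ {Ω : Type*} (ξ : ℕ → Ω → ℝ) (m : ℕ) (ω : Ω) :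
    walk ξ (m + 1) ω = walk ξ m ω + ξ m ω := Finset.sum_range_succ _ _

lemma measurable_walk (hξ : ∀ m, Measurable (ξ m)) (m : ℕ) : Measurable (walk ξ m) := by
  unfold walk
  fun_prop

lemma measure_walk_succ_le [IsProbabilityMeasure P] (h : IsScheme P p X ξ) (m : ℕ) (t : ℝ) :
    P {ω | walk ξ (m + 1) ω ≤ t}
      = ∫⁻ y, exponentialPDF 1 y * P {ω | walk ξ m ω ≤ t - y} := by
  have hw := measurable_walk h.measurable_incr m
  have hind : IndepFun (walk ξ m) (ξ m) P := by
    have := h.indep_incr.indepFun_finsetSum_of_notMem h.measurable_incr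
      (s := Finset.range m) (i := m) (by simp)
    have e : walk ξ m = ∑ j ∈ Finset.range m, ξ j := by
      ext ω; simp [walk]
    rwa [e]
  have hprod := (indepFun_iff_map_prod_eq_prod_map_map hw.aemeasurable
    (h.measurable_incr m).aemeasurable).1 hind
  have hs : MeasurableSet {c : ℝ × ℝ | c.1 + c.2 ≤ t} :=
    measurableSet_le (by fun_prop) measurable_const
  have e1 : P {ω | walk ξ (m + 1) ω ≤ t}
      = (P.map fun ω => (walk ξ m ω, ξ m ω)) {c : ℝ × ℝ | c.1 + c.2 ≤ t} := by
    rw [Measure.map_apply (hw.prodMk (h.measurable_incr m)) hs]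
    congr 1
    ext ω
    simp [walk_succ]
  have : IsProbabilityMeasure (P.map (walk ξ m)) := Measure.isProbabilityMeasure_map hw.aemeasurable
  have : IsProbabilityMeasure (P.map (ξ m)) :=
    Measure.isProbabilityMeasure_map (h.measurable_incr m).aemeasurable
  rw [e1, hprod, Measure.prod_apply_symm hs]
  have hmeas := measurable_measure_prodMk_right (μ := P.map (walk ξ m)) hs
  rw [h.law_incr m]
  have e2 : expMeasure 1 = volume.withDensity (exponentialPDF 1) := rfl
  have hpdf : Measurable (exponentialPDF 1) :=
    (measurable_exponentialPDFReal 1).ennreal_ofReal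
  rw [e2, lintegral_withDensity_eq_lintegral_mul _ hpdf hmeas]
  refine lintegral_congr fun y => ?_
  rw [Pi.mul_apply, Measure.map_apply hw (hs.preimage (by fun_prop))]
  congr 2
  ext ω
  simp [le_sub_iff_add_le]

lemma measure_walk_le [IsProbabilityMeasure P] (h : IsScheme P p X ξ) (m : ℕ) (t : ℝ) :
    P.real {ω | walk ξ m ω ≤ t} = if 0 ≤ t then poissonTail t m else 0 := by
  induction m generalizing t with
  | zero =>
    split_ifs with ht <;> simp [walk, ht]
  | succ m ih =>
    have key : P {ω | walk ξ (m + 1) ω ≤ t}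
        = ENNReal.ofReal (∫ y in Set.Icc 0 t, Real.exp (-y) * poissonTail (t - y) m) := by
      -- The tail is nonnegative because the induction hypothesis identifies it with a probability.
      have hnn : ∀ y ∈ Set.Icc 0 t, 0 ≤ Real.exp (-y) * poissonTail (t - y) m := by
        intro y hy
        refine mul_nonneg (Real.exp_pos _).le ?_
        have := ih (t - y)
        rw [if_pos (by linarith [hy.2])] at this
        rw [← this]
        exact measureReal_nonneg
      rw [measure_walk_succ_le h, ofReal_integral_eq_lintegral_ofReal]
      · rw [← lintegral_indicator measurableSet_Icc]
        refine lintegral_congr fun y => ?_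
        rw [← ofReal_measureReal, ih]
        rcases lt_or_ge y 0 with hy | hy
        · rw [exponentialPDF_of_neg hy, Set.indicator_of_notMem (by simp [hy])]
          simp
        · rw [exponentialPDF_of_nonneg hy]
          by_cases hyt : y ≤ t
          · rw [if_pos (by linarith), Set.indicator_of_mem (Set.mem_Icc.2 ⟨hy, hyt⟩),
              ← ENNReal.ofReal_mul (by positivity)]
            simp
          · rw [if_neg (by linarith), Set.indicator_of_notMem (by simp [hyt])]
            simp
      · have := continuous_poissonTail m
        exact Continuous.integrableOn_Icc (by fun_prop)
      · exact (ae_restrict_iff' measurableSet_Icc).2 (Eventually.of_forall hnn)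
    split_ifs with ht
    · have e : 0 ≤ ∫ y in Set.Icc 0 t, Real.exp (-y) * poissonTail (t - y) m := by
        refine setIntegral_nonneg measurableSet_Icc fun y hy => ?_
        refine mul_nonneg (Real.exp_pos _).le ?_
        have := ih (t - y)
        rw [if_pos (by linarith [hy.2])] at this
        rw [← this]
        exact measureReal_nonneg
      rw [measureReal_def, key, ENNReal.toReal_ofReal e, integral_exp_neg_mul_poissonTail ht]
    · rw [measureReal_def, key, Set.Icc_eq_empty (by linarith)]
      simp

/-- The number of arrivals up to time `t`, as the index of the first arrival after `t`. -/
def arrivalIndex {Ω : Type*} (ξ : ℕ → Ω → ℝ) (t : ℝ) (ω : Ω) : ℕ := sInf {m | t < arrival ξ m ω}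

lemma measurable_arrival (hξ : ∀ m, Measurable (ξ m)) (m : ℕ) : Measurable (arrival ξ m) :=
  measurable_walk hξ (m + 1)

lemma measurable_arrivalIndex (hξ : ∀ m, Measurable (ξ m)) (t : ℝ) :
    Measurable (arrivalIndex ξ t) := by
  have hE : ∀ m, MeasurableSet {ω | t < arrival ξ m ω} := fun m =>
    measurableSet_lt measurable_const (measurable_arrival hξ m)
  refine measurable_to_countable' fun m => ?_
  -- Since `sInf ∅ = 0`, the event that no arrival exceeds t must be added to the fibre over 0.
  have e : arrivalIndex ξ t ⁻¹' {m}
      = ({ω | t < arrival ξ m ω} ∩ ⋂ i ∈ Finset.range m, {ω | t < arrival ξ i ω}ᶜ) ∪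
        (if m = 0 then ⋂ i, {ω | t < arrival ξ i ω}ᶜ else ∅) := by
    ext ω
    simp only [Set.mem_preimage, Set.mem_singleton_iff, arrivalIndex, Set.mem_union,
      Set.mem_inter_iff, Set.mem_iInter, Finset.mem_range, Set.mem_compl_iff, Set.mem_ofPred_eq]
    constructor
    · intro hm
      rcases Set.eq_empty_or_nonempty {m | t < arrival ξ m ω} with he | hne
      · right
        have h0 : m = 0 := by rw [← hm, he, Nat.sInf_empty]
        rw [if_pos h0]
        simp only [Set.mem_iInter]
        intro i hi
        have : i ∈ {m | t < arrival ξ m ω} := hi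
        simp [he] at this
      · left
        refine ⟨hm ▸ Nat.sInf_mem hne, fun i hi => ?_⟩
        rw [← hm] at hi
        exact Nat.notMem_of_lt_sInf hi
    · rintro (⟨h1, h2⟩ | h1)
      · refine le_antisymm (Nat.sInf_le h1) ?_
        by_contra hlt
        exact h2 _ (not_le.1 hlt) (Nat.sInf_mem (s := {m | t < arrival ξ m ω}) ⟨m, h1⟩)
      · split_ifs at h1 with h0
        · simp only [Set.mem_iInter] at h1
          rw [h0, Nat.sInf_eq_zero]
          right
          ext i
          simpa using h1 i
        · exact absurd h1 (Set.notMem_empty _)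
  rw [e]
  refine MeasurableSet.union ((hE m).inter (Finset.measurableSet_biInter _ fun i _ => (hE i).compl))
    ?_
  split_ifs
  · exact MeasurableSet.iInter fun i => (hE i).compl
  · exact MeasurableSet.empty

lemma tendsto_poissonTail_atTop (t : ℝ) : Tendsto (poissonTail t) atTop (𝓝 0) := by
  have := (hasSum_poissonMass t).tendsto_sum_nat.const_sub 1
  rw [sub_self] at this
  exact this

/-- Almost surely the increments are nonnegative. -/
lemma ae_incr_nonneg [IsProbabilityMeasure P] (h : IsScheme P p X ξ) :
    ∀ᵐ ω ∂P, ∀ m, 0 ≤ ξ m ω := by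
  refine ae_all_iff.2 fun m => ?_
  have h1 : ∀ᵐ y ∂(P.map (ξ m)), 0 ≤ y := by
    rw [h.law_incr m, ae_iff]
    have e : {y : ℝ | ¬ 0 ≤ y} = Set.Iio 0 := by ext; simp
    have e2 : expMeasure 1 = volume.withDensity (exponentialPDF 1) := rfl
    rw [e, e2, withDensity_apply _ measurableSet_Iio]
    exact lintegral_exponentialPDF_of_nonpos le_rfl
  exact ae_of_ae_map (h.measurable_incr m).aemeasurable h1

/-- The exceptional event forces the walk to be at most t after every number of steps, and those
probabilities are Poisson tails tending to 0. -/
lemma ae_exists_lt_arrival [IsProbabilityMeasure P] (h : IsScheme P p X ξ) {t : ℝ} (ht : 0 ≤ t) :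
    ∀ᵐ ω ∂P, ∃ m, t < arrival ξ m ω := by
  rw [ae_iff]
  have hb : ∀ m, P.real {ω | ¬ ∃ m, t < arrival ξ m ω} ≤ poissonTail t (m + 1) := by
    intro m
    have := measure_walk_le h (m + 1) t
    rw [if_pos ht] at this
    rw [← this]
    refine measureReal_mono (fun ω hω => ?_)
    simp only [Set.mem_ofPred_eq, not_exists, not_lt] at hω
    exact hω m
  have h0 := ge_of_tendsto' ((tendsto_poissonTail_atTop t).comp (tendsto_add_atTop_nat 1)) hb
  exact (measureReal_eq_zero_iff).1 (le_antisymm h0 measureReal_nonneg)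

lemma walk_mono {Ω : Type*} {ξ : ℕ → Ω → ℝ} {ω : Ω} (h : ∀ m, 0 ≤ ξ m ω) : Monotone fun m => walk ξ m ω :=
  monotone_nat_of_le_succ fun m => by simp only [walk_succ]; linarith [h m]

lemma arrival_le_iff {Ω : Type*} {ξ : ℕ → Ω → ℝ} {ω : Ω} {t : ℝ} (h : ∀ m, 0 ≤ ξ m ω) (h' : ∃ m, t < arrival ξ m ω) (m : ℕ) :
    arrival ξ m ω ≤ t ↔ m < arrivalIndex ξ t ω := by
  have hmem : t < arrival ξ (arrivalIndex ξ t ω) ω := Nat.sInf_mem (s := {m | t < arrival ξ m ω}) h'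
  constructor
  · intro hm
    by_contra hlt
    have := walk_mono h (Nat.succ_le_succ (not_lt.1 hlt))
    exact absurd (hmem.trans_le this) (not_lt.2 hm)
  · intro hm
    exact not_lt.1 (Nat.notMem_of_lt_sInf hm)

lemma arrivalIndex_eq_iff {Ω : Type*} {ξ : ℕ → Ω → ℝ} {ω : Ω} {t : ℝ} (ht : 0 ≤ t) (h : ∀ m, 0 ≤ ξ m ω)
    (h' : ∃ m, t < arrival ξ m ω) (m : ℕ) :
    arrivalIndex ξ t ω = m ↔ walk ξ m ω ≤ t ∧ ¬ walk ξ (m + 1) ω ≤ t := by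
  have h1 : walk ξ (m + 1) ω ≤ t ↔ m < arrivalIndex ξ t ω := arrival_le_iff h h' m
  have h2 : walk ξ m ω ≤ t ↔ m ≤ arrivalIndex ξ t ω := by
    cases m with
    | zero => simp [walk, ht]
    | succ m => exact arrival_le_iff h h' m
  rw [h1, h2]; omega

/-- Almost surely the index is m exactly when t lies between consecutive positions m and m + 1 of
the walk, so its mass is a difference of two Poisson tails. -/
lemma measureReal_arrivalIndex [IsProbabilityMeasure P] (h : IsScheme P p X ξ) {t : ℝ}
    (ht : 0 ≤ t) (m : ℕ) : P.real {ω | arrivalIndex ξ t ω = m} = poissonMass t m := by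
  have e : {ω | arrivalIndex ξ t ω = m}
      =ᵐ[P] ({ω | walk ξ m ω ≤ t} \ {ω | walk ξ (m + 1) ω ≤ t} : Set Ω) := by
    filter_upwards [ae_incr_nonneg h, ae_exists_lt_arrival h ht] with ω h1 h2
    exact propext (arrivalIndex_eq_iff ht h1 h2 m)
  have e' : ({ω | walk ξ m ω ≤ t} ∩ {ω | walk ξ (m + 1) ω ≤ t} : Set Ω)
      =ᵐ[P] {ω | walk ξ (m + 1) ω ≤ t} := by
    filter_upwards [ae_incr_nonneg h] with ω h1
    exact propext ⟨fun hω => hω.2, fun hω => ⟨(walk_mono h1 (Nat.le_succ m)).trans hω, hω⟩⟩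
  have hms : MeasurableSet {ω | walk ξ (m + 1) ω ≤ t} :=
    measurableSet_le (measurable_walk h.measurable_incr _) measurable_const
  have h3 := measureReal_inter_add_sdiff (μ := P) (s := {ω | walk ξ m ω ≤ t}) hms
  rw [measureReal_congr e', measure_walk_le h, measure_walk_le h, if_pos ht, if_pos ht] at h3
  rw [measureReal_congr e]
  have := poissonTail_succ t m
  linarith

lemma indepFun_arrivalIndex (h : IsScheme P p X ξ) (t : ℝ) :
    IndepFun (fun ω m => X m ω) (arrivalIndex ξ t) P :=
  h.indep_box_incr.comp (φ := id)
    (ψ := arrivalIndex (fun m (x : ℕ → ℝ) => x m) t) measurable_id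
    (measurable_arrivalIndex (fun m => measurable_pi_apply m) t)

/-! ### Sampling the occupancy counts at the number of arrivals -/

lemma measureReal_arrivalIndex_inter_boxCount [IsProbabilityMeasure P] (h : IsScheme P p X ξ)
    {t : ℝ} (ht : 0 ≤ t) (m k l a b : ℕ) :
    P.real ({ω | a ≤ boxCount X m k ω ∧ b ≤ boxCount X m l ω} ∩ {ω | arrivalIndex ξ t ω = m})
      = poissonMass t m * P.real {ω | a ≤ boxCount X m k ω ∧ b ≤ boxCount X m l ω} := by
  have hX : ∀ m, Measurable (fun x : ℕ → ℕ => x m) := fun m => measurable_pi_apply m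
  have := (indepFun_arrivalIndex h t).measure_inter_preimage_eq_mul
    {x : ℕ → ℕ | a ≤ boxCount (fun m (x : ℕ → ℕ) => x m) m k x ∧
      b ≤ boxCount (fun m (x : ℕ → ℕ) => x m) m l x} {m}
    ((measurableSet_le_boxCount hX m k a).inter (measurableSet_le_boxCount hX m l b))
    (MeasurableSet.of_discrete)
  rw [← measureReal_arrivalIndex h ht m, mul_comm]
  simp only [measureReal_def, ← ENNReal.toReal_mul]
  exact congrArg ENNReal.toReal this

lemma measurableSet_le_boxCount_arrivalIndex (h : IsScheme P p X ξ) (t : ℝ) (k a : ℕ) :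
    MeasurableSet {ω | a ≤ boxCount X (arrivalIndex ξ t ω) k ω} := by
  have e : {ω | a ≤ boxCount X (arrivalIndex ξ t ω) k ω}
      = ⋃ m, ({ω | a ≤ boxCount X m k ω} ∩ {ω | arrivalIndex ξ t ω = m}) := by
    ext ω; simp
  rw [e]
  exact MeasurableSet.iUnion fun m => (measurableSet_le_boxCount h.measurable_box m k a).inter
    (measurable_arrivalIndex h.measurable_incr t (measurableSet_singleton m))

lemma hasSum_measureReal_pair_arrivalIndex [IsProbabilityMeasure P] (h : IsScheme P p X ξ)
    {t : ℝ} (ht : 0 ≤ t) (k l a b : ℕ) :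
    HasSum (fun m => poissonMass t m * P.real {ω | a ≤ boxCount X m k ω ∧ b ≤ boxCount X m l ω})
      (P.real ({ω | a ≤ boxCount X (arrivalIndex ξ t ω) k ω} ∩
        {ω | b ≤ boxCount X (arrivalIndex ξ t ω) l ω})) := by
  set S := {ω | a ≤ boxCount X (arrivalIndex ξ t ω) k ω} ∩
        {ω | b ≤ boxCount X (arrivalIndex ξ t ω) l ω} with hS
  have mS : MeasurableSet S := (measurableSet_le_boxCount_arrivalIndex h t k a).inter
    (measurableSet_le_boxCount_arrivalIndex h t l b)
  have hX := h.measurable_box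
  have h1 := hasSum_measureReal_of_indicator (P := P) (W := S.indicator fun _ => (1 : ℝ))
    (B := fun m => {ω | a ≤ boxCount X m k ω ∧ b ≤ boxCount X m l ω} ∩
      {ω | arrivalIndex ξ t ω = m})
    (fun m => ((measurableSet_le_boxCount hX m k a).inter
      (measurableSet_le_boxCount hX m l b)).inter
      (measurable_arrivalIndex h.measurable_incr t (measurableSet_singleton m)))
    ((integrable_const (1 : ℝ)).indicator mS)
    (Eventually.of_forall fun ω => by
      have := hasSum_single (f := fun m => ({ω | a ≤ boxCount X m k ω ∧ b ≤ boxCount X m l ω} ∩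
        {ω | arrivalIndex ξ t ω = m}).indicator (fun _ => (1 : ℝ)) ω) (arrivalIndex ξ t ω)
        (fun m hm => Set.indicator_of_notMem (fun hω => hm hω.2.symm) _)
      convert this using 1
      by_cases hω : ω ∈ S
      · rw [Set.indicator_of_mem hω]
        symm
        apply Set.indicator_of_mem
        exact ⟨hω, rfl⟩
      · rw [Set.indicator_of_notMem hω, Set.indicator_of_notMem (fun h' => hω h'.1)])
  rw [integral_indicator_const _ mS, smul_eq_mul, mul_one] at h1
  refine h1.congr_fun fun m => ?_
  exact (measureReal_arrivalIndex_inter_boxCount h ht m k l a b).symm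

lemma measureReal_boxCount_arrivalIndex [IsProbabilityMeasure P] (h : IsScheme P p X ξ)
    {t : ℝ} (ht : 0 ≤ t) (k a : ℕ) :
    P.real {ω | a ≤ boxCount X (arrivalIndex ξ t ω) k ω} = poissonTail (t * p k) a := by
  have h1 := hasSum_measureReal_pair_arrivalIndex h ht k k a a
  simp only [and_self, Set.inter_self, measureReal_boxCount h] at h1
  exact h1.unique (hasSum_poissonMass_binTail t (p k) a)

/-- Conditioning on the independent Poisson number of balls gives the product directly; this removes
all off-diagonal covariances. -/
lemma measureReal_pair_boxCount_arrivalIndex [IsProbabilityMeasure P] (h : IsScheme P p X ξ)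
    {t : ℝ} (ht : 0 ≤ t) {k l : ℕ} (hkl : k ≠ l) (a b : ℕ) :
    P.real ({ω | a ≤ boxCount X (arrivalIndex ξ t ω) k ω} ∩
        {ω | b ≤ boxCount X (arrivalIndex ξ t ω) l ω})
      = poissonTail (t * p k) a * poissonTail (t * p l) b := by
  have h1 := hasSum_measureReal_pair_arrivalIndex h ht k l a b
  simp only [measureReal_pair_boxCount h hkl] at h1
  exact h1.unique (hasSum_poissonMass_jointTail t (p k) (p l) a b)

/-- Reduces the Poissonized scheme to the deterministic one sampled at a random number of balls. -/
lemma poissonCount_ae_eq [IsProbabilityMeasure P] (h : IsScheme P p X ξ) {t : ℝ} (ht : 0 ≤ t)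
    (j : ℕ) :
    poissonCount X ξ j t =ᵐ[P] fun ω => detCount X j (arrivalIndex ξ t ω) ω := by
  filter_upwards [ae_incr_nonneg h, ae_exists_lt_arrival h ht] with ω h1 h2
  simp only [poissonCount, detCount, arrival_le_iff h1 h2]

lemma integrable_sq_arrivalIndex [IsProbabilityMeasure P] (h : IsScheme P p X ξ) {t : ℝ}
    (ht : 0 ≤ t) : Integrable (fun ω => (arrivalIndex ξ t ω : ℝ) ^ 2) P := by
  have hm := measurable_arrivalIndex h.measurable_incr t
  have hg : Measurable fun n : ℕ => (n : ℝ) ^ 2 := Measurable.of_discrete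
  have : IsProbabilityMeasure (P.map (arrivalIndex ξ t)) :=
    Measure.isProbabilityMeasure_map hm.aemeasurable
  have hlaw : P.map (arrivalIndex ξ t) = poissonMeasure t.toNNReal := by
    refine Measure.ext_of_singleton fun n => ?_
    rw [← ENNReal.toReal_eq_toReal_iff' (measure_ne_top _ _) (measure_ne_top _ _),
      ← measureReal_def, ← measureReal_def, poissonMeasure_real_singleton,
      Real.coe_toNNReal t ht, map_measureReal_apply hm
      (measurableSet_singleton n)]
    exact measureReal_arrivalIndex h ht n
  have hint : Integrable (fun n : ℕ => (n : ℝ) ^ 2) (P.map (arrivalIndex ξ t)) := by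
    rw [hlaw, integrable_poissonMeasure_iff]
    -- The argument 4 t comes from the crude bound n² ≤ 4ⁿ.
    have h4 := (Real.summable_pow_div_factorial (4 * t)).mul_left (Real.exp (-t))
    refine Summable.of_nonneg_of_le (fun n => by positivity) (fun n => ?_) h4
    have h5 : (n : ℝ) ^ 2 ≤ 4 ^ n := by
      have : (n : ℝ) ≤ 2 ^ n := by exact_mod_cast (Nat.lt_two_pow_self (n := n)).le
      calc (n : ℝ) ^ 2 ≤ (2 ^ n) ^ 2 := by gcongr
        _ = 4 ^ n := by rw [← pow_mul, mul_comm, pow_mul]; norm_num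
    have e : ‖(n : ℝ) ^ 2‖ = (n : ℝ) ^ 2 := by
      rw [Real.norm_eq_abs, abs_of_nonneg (by positivity)]
    simp only [e, mul_pow, Real.coe_toNNReal t ht]
    have h6 : 0 ≤ Real.exp (-t) * t ^ n / n.factorial := by positivity
    calc _ ≤ Real.exp (-t) * t ^ n / n.factorial * 4 ^ n := by gcongr
      _ = _ := by ring
  exact hint.comp_measurable hm

lemma measurable_detCount_arrivalIndex (h : IsScheme P p X ξ) (t : ℝ)
    {j : ℕ} (hj : 1 ≤ j) : Measurable fun ω => detCount X j (arrivalIndex ξ t ω) ω := by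
  have h2 : (fun ω => detCount X j (arrivalIndex ξ t ω) ω) = fun ω => ∑' k,
      ({ω | j ≤ boxCount X (arrivalIndex ξ t ω) k ω}).indicator (fun _ => (1 : ℝ)) ω := by
    funext ω
    rw [detCount_eq]
    exact (hasSum_indicator_ncard (A := fun k => {ω | j ≤ boxCount X (arrivalIndex ξ t ω) k ω})
      ((Finset.finite_toSet _).subset (setOf_le_boxCount_subset X _ ω hj))).tsum_eq.symm
  rw [h2]
  exact Measurable.tsum fun k =>
    measurable_const.indicator (measurableSet_le_boxCount_arrivalIndex h t k j)

lemma memLp_poissonCount [IsProbabilityMeasure P] (h : IsScheme P p X ξ) {t : ℝ} (ht : 0 ≤ t)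
    {j : ℕ} (hj : 1 ≤ j) : MemLp (poissonCount X ξ j t) 2 P := by
  have hm := (measurable_detCount_arrivalIndex h t hj).aestronglyMeasurable (μ := P)
  have : MemLp (fun ω => detCount X j (arrivalIndex ξ t ω) ω) 2 P := by
    rw [memLp_two_iff_integrable_sq hm]
    refine (integrable_sq_arrivalIndex h ht).mono' (hm.pow 2) (Eventually.of_forall fun ω => ?_)
    rw [Real.norm_eq_abs, abs_of_nonneg (by positivity)]
    exact pow_le_pow_left₀ (detCount_nonneg _ _ _ _) (detCount_le X _ ω hj) 2
  exact this.ae_eq (poissonCount_ae_eq h ht j).symm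

/-- The variance of the Poissonized count, written as a double sum. -/
lemma hasSum_variance_poissonCount [IsProbabilityMeasure P] (h : IsScheme P p X ξ) {t : ℝ}
    (ht : 0 ≤ t) {j : ℕ} (hj : 1 ≤ j) :
    HasSum (fun c : ℕ × ℕ => if c.1 = c.2
        then poissonTail (t * p c.1) j * (1 - poissonTail (t * p c.1) j) else 0)
      (variance (poissonCount X ξ j t) P) := by
  have := hasSum_variance_ncard (P := P) (Z := poissonCount X ξ j t)
    (A := fun k => {ω | j ≤ boxCount X (arrivalIndex ξ t ω) k ω})
    (fun k => measurableSet_le_boxCount_arrivalIndex h t k j)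
    ((poissonCount_ae_eq h ht j).mono fun ω hω => ⟨(Finset.finite_toSet _).subset
      (setOf_le_boxCount_subset X _ ω hj), hω.trans (detCount_eq X j _ ω)⟩)
    (memLp_poissonCount h ht hj)
  refine this.congr_fun fun c => ?_
  split_ifs with hc
  · rw [hc, Set.inter_self, measureReal_boxCount_arrivalIndex h ht]; ring
  · rw [measureReal_pair_boxCount_arrivalIndex h ht hc, measureReal_boxCount_arrivalIndex h ht,
      measureReal_boxCount_arrivalIndex h ht]
    ring

end Walk

/-! ### Pointwise estimates -/

lemma binTail_mem_Icc {p : ℝ} (hp : 0 ≤ p) (hp1 : p ≤ 1) (m a : ℕ) :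
    binTail p m a ∈ Set.Icc (0 : ℝ) 1 := by
  induction m generalizing a with
  | zero => simp only [binTail]; split_ifs <;> simp
  | succ m ih =>
    have h1 := ih (a - 1)
    have h2 := ih a
    have hq : 0 ≤ 1 - p := by linarith
    simp only [binTail]
    refine ⟨add_nonneg (mul_nonneg hp h1.1) (mul_nonneg hq h2.1), ?_⟩
    have := mul_le_mul_of_nonneg_left h1.2 hp
    have := mul_le_mul_of_nonneg_left h2.2 hq
    linarith

lemma poissonTail_nonneg {x : ℝ} (hx : 0 ≤ x) (a : ℕ) : 0 ≤ poissonTail x a := by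
  have := sum_le_hasSum (Finset.range a) (fun i _ => poissonMass_nonneg hx i) (hasSum_poissonMass x)
  unfold poissonTail; linarith

lemma poissonTail_le_one {x : ℝ} (hx : 0 ≤ x) (a : ℕ) : poissonTail x a ≤ 1 := by
  have := Finset.sum_nonneg (s := Finset.range a) fun i _ => poissonMass_nonneg hx i
  unfold poissonTail; linarith

lemma abs_mul_one_sub_sub_le {b q : ℝ} (hb : b ∈ Set.Icc (0 : ℝ) 1) (hq : q ∈ Set.Icc (0 : ℝ) 1) :
    |b * (1 - b) - q * (1 - q)| ≤ |b - q| := by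
  rw [show b * (1 - b) - q * (1 - q) = (b - q) * (1 - b - q) by ring, abs_mul]
  refine mul_le_of_le_one_right (abs_nonneg _) ?_
  rw [abs_le]
  constructor <;> linarith [hb.1, hb.2, hq.1, hq.2]

/-- The function of the expected box content that controls all error terms. -/
def weight (i : ℕ) (x : ℝ) : ℝ := (x ^ (i + 1) + x ^ (i + 2)) * Real.exp (-x)

lemma weight_nonneg {x : ℝ} (hx : 0 ≤ x) (i : ℕ) : 0 ≤ weight i x := by unfold weight; positivity

lemma one_le_exp_one : 1 ≤ Real.exp 1 := Real.one_le_exp zero_le_one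

lemma envelope_le {p : ℝ} (hp : 0 ≤ p) (n i : ℕ) :
    envelope p n i ≤ Real.exp 1 ^ i * ((n * p) ^ i * Real.exp (-(n * p))) := by
  unfold envelope
  have h1 : (1 : ℝ) ≤ i.factorial := by exact_mod_cast i.factorial_pos
  have h2 : (n * (Real.exp 1 * p)) ^ i / i.factorial ≤ (n * (Real.exp 1 * p)) ^ i :=
    div_le_self (by positivity) h1
  calc _ ≤ (n * (Real.exp 1 * p)) ^ i * Real.exp (-(n * p)) := by gcongr
    _ = _ := by rw [show (n : ℝ) * (Real.exp 1 * p) = Real.exp 1 * (n * p) by ring, mul_pow]; ring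

/-- Writing n p q as (n p)(n q) / n raises each power by one and leaves the decisive factor 1 / n.
-/
lemma abs_tailCov_le_weight {p q : ℝ} (hp : 0 ≤ p) (hq : 0 ≤ q) (hpq : p + q ≤ 1) {n : ℕ}
    (hn : 0 < n) (i : ℕ) :
    |tailCov p q n (i + 1) (i + 1)|
      ≤ Real.exp 1 ^ (2 * i + 1) / n * (weight i (n * p) * weight i (n * q)) := by
  have hn' : (0 : ℝ) < n := by exact_mod_cast hn
  have hw : ∀ {r : ℝ}, 0 ≤ r → (n * r) ^ (i + 1) * Real.exp (-(n * r)) ≤ weight i (n * r) := by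
    intro r hr
    unfold weight
    have : 0 ≤ (n * r : ℝ) ^ (i + 2) := by positivity
    gcongr
    linarith
  calc _ ≤ n * Real.exp 1 * (p * q) * (envelope p n i * envelope q n i) :=
        abs_tailCov_le hp hq hpq n i i
    _ ≤ n * Real.exp 1 * (p * q) * ((Real.exp 1 ^ i * ((n * p) ^ i * Real.exp (-(n * p))))
          * (Real.exp 1 ^ i * ((n * q) ^ i * Real.exp (-(n * q))))) := by
        have := envelope_le hp n i
        have := envelope_le hq n i
        have := envelope_nonneg hq n i
        gcongr
    _ = Real.exp 1 ^ (2 * i + 1) / n * (((n * p) ^ (i + 1) * Real.exp (-(n * p)))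
          * ((n * q) ^ (i + 1) * Real.exp (-(n * q)))) := by
        field_simp
        ring
    _ ≤ _ := by
        have := hw hp
        have := hw hq
        gcongr
        exact weight_nonneg (by positivity) i

lemma abs_binTail_sub_poissonTail_le_weight {p : ℝ} (hp : 0 ≤ p) (hp1 : p ≤ 1) {n : ℕ}
    (hn : 0 < n) (i : ℕ) :
    |binTail p n (i + 1) - poissonTail (n * p) (i + 1)|
      ≤ Real.exp 1 ^ (2 * i + 1) / n * weight i (n * p) := by
  have hn' : (0 : ℝ) < n := by exact_mod_cast hn
  have he := one_le_exp_one
  -- The two members of the pair, at i and i - 1, produce the powers i + 2 and i + 1 in `weight`.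
  have h1 : (n * p) ^ 2 * envelopePair p n i ≤ Real.exp 1 ^ (2 * i) * weight i (n * p) := by
    unfold envelopePair weight
    rcases i with _ | i
    · have := envelope_le hp n 0
      rw [if_pos rfl, add_zero]
      calc (n * p) ^ 2 * envelope p n 0 ≤ (n * p) ^ 2 * Real.exp (-(n * p)) := by
            gcongr; simpa using this
        _ ≤ _ := by
            have : 0 ≤ (n * p : ℝ) := by positivity
            simp only [mul_zero, pow_zero, one_mul, zero_add, pow_one]
            gcongr; linarith
    · have e1 := envelope_le hp n (i + 1)
      have e2 := envelope_le hp n i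
      rw [if_neg (Nat.succ_ne_zero i), Nat.add_sub_cancel]
      have f1 : Real.exp 1 ^ (i + 1) ≤ Real.exp 1 ^ (2 * (i + 1)) :=
        pow_le_pow_right₀ he (by omega)
      have f2 : Real.exp 1 ^ i ≤ Real.exp 1 ^ (2 * (i + 1)) :=
        pow_le_pow_right₀ he (by omega)
      calc (n * p) ^ 2 * (envelope p n (i + 1) + envelope p n i)
          ≤ (n * p) ^ 2 * (Real.exp 1 ^ (2 * (i + 1)) * ((n * p) ^ (i + 1) * Real.exp (-(n * p)))
            + Real.exp 1 ^ (2 * (i + 1)) * ((n * p) ^ i * Real.exp (-(n * p)))) := by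
            gcongr
            · refine e1.trans ?_
              gcongr
            · refine e2.trans ?_
              gcongr
        _ = _ := by ring
  calc _ ≤ n * Real.exp 1 * p ^ 2 * envelopePair p n i := abs_binTail_sub_poissonTail_le hp hp1 n i
    _ = Real.exp 1 / n * ((n * p) ^ 2 * envelopePair p n i) := by field_simp
    _ ≤ Real.exp 1 / n * (Real.exp 1 ^ (2 * i) * weight i (n * p)) := by gcongr
    _ = _ := by ring

lemma pow_mul_exp_neg_le {x : ℝ} (hx : 0 ≤ x) (i : ℕ) : x ^ i * Real.exp (-x) ≤ i.factorial := by
  have h := Real.pow_div_factorial_le_exp x hx i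
  rw [div_le_iff₀ (by positivity)] at h
  rw [Real.exp_neg, ← div_eq_mul_inv, div_le_iff₀ (Real.exp_pos _)]
  linarith

lemma weight_eq (i : ℕ) (x : ℝ) :
    weight i x = x * (x ^ i * Real.exp (-x) + x ^ (i + 1) * Real.exp (-x)) := by
  unfold weight; ring

lemma weight_le_mul {x : ℝ} (hx : 0 ≤ x) (i : ℕ) :
    weight i x ≤ x * (i.factorial + (i + 1).factorial) := by
  rw [weight_eq]
  have := pow_mul_exp_neg_le hx i
  have := pow_mul_exp_neg_le hx (i + 1)
  gcongr

/-! ### Sums over the boxes -/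

section Sums

variable {p : ℕ → ℝ}

lemma summable_weight (hp0 : ∀ k, 0 ≤ p k) (hp : Summable p) (i n : ℕ) :
    Summable fun k => weight i (n * p k) := by
  refine Summable.of_nonneg_of_le (fun k => weight_nonneg (mul_nonneg n.cast_nonneg (hp0 k)) i)
    (fun k => weight_le_mul (mul_nonneg n.cast_nonneg (hp0 k)) i) ?_
  exact (hp.mul_left _).mul_right _

/-- The total weight at time `n`. -/
def totalWeight (p : ℕ → ℝ) (i n : ℕ) : ℝ := ∑' k, weight i (n * p k)

/-- After division by n, each term is p_k times a bounded function of n p_k that vanishes at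
infinity; constant multiples of p_k dominate. -/
lemma tendsto_totalWeight_div (hp0 : ∀ k, 0 ≤ p k) (hp : Summable p) (i : ℕ) :
    Tendsto (fun n : ℕ => totalWeight p i n / n) atTop (𝓝 0) := by
  have h : Tendsto (fun n : ℕ => ∑' k, p k * ((n * p k) ^ i * Real.exp (-(n * p k))
      + (n * p k) ^ (i + 1) * Real.exp (-(n * p k)))) atTop (𝓝 (∑' _ : ℕ, 0)) := by
    refine tendsto_tsum_of_dominated_convergence
      (bound := fun k => p k * (i.factorial + (i + 1).factorial)) (hp.mul_right _) (fun k => ?_)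
      (Eventually.of_forall fun n k => ?_)
    · rcases (hp0 k).eq_or_lt with h0 | h0
      · simp [← h0]
      · have ht : Tendsto (fun n : ℕ => (n : ℝ) * p k) atTop atTop :=
          tendsto_natCast_atTop_atTop.atTop_mul_const h0
        have h1 := (Real.tendsto_pow_mul_exp_neg_atTop_nhds_zero i).comp ht
        have h2 := (Real.tendsto_pow_mul_exp_neg_atTop_nhds_zero (i + 1)).comp ht
        simpa using (h1.add h2).const_mul (p k)
    · have hx : 0 ≤ (n : ℝ) * p k := mul_nonneg n.cast_nonneg (hp0 k)
      have := hp0 k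
      rw [Real.norm_eq_abs, abs_of_nonneg (by positivity)]
      have := pow_mul_exp_neg_le hx i
      have := pow_mul_exp_neg_le hx (i + 1)
      gcongr
  rw [tsum_zero] at h
  refine h.congr' ?_
  filter_upwards [eventually_gt_atTop 0] with n hn
  have hn' : (n : ℝ) ≠ 0 := by exact_mod_cast hn.ne'
  rw [totalWeight, ← tsum_div_const]
  refine tsum_congr fun k => ?_
  rw [weight_eq]
  field_simp

/-- The Poisson variance of a single box indicator. -/
def boxVar (i : ℕ) (x : ℝ) : ℝ := poissonTail x (i + 1) * (1 - poissonTail x (i + 1))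

/-- The tail is at least its first point mass, and the complement is at least the mass at 0. -/
lemma le_boxVar {x : ℝ} (hx : 0 ≤ x) (i : ℕ) :
    x ^ (i + 1) * Real.exp (-(2 * x)) / (i + 1).factorial ≤ boxVar i x := by
  have h1 : poissonMass x (i + 1) ≤ poissonTail x (i + 1) := by
    have := poissonTail_succ x (i + 1)
    have := poissonTail_nonneg hx (i + 2)
    linarith
  have h2 : poissonMass x 0 ≤ 1 - poissonTail x (i + 1) := by
    rw [poissonTail, sub_sub_cancel]
    exact Finset.single_le_sum (f := fun a => poissonMass x a) (fun a _ => poissonMass_nonneg hx a)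
      (Finset.mem_range.2 (Nat.succ_pos i))
  have h3 := mul_le_mul h1 h2 (poissonMass_nonneg hx 0) (poissonTail_nonneg hx _)
  refine le_trans (le_of_eq ?_) h3
  simp only [poissonMass, pow_zero, Nat.factorial_zero, Nat.cast_one, div_one, mul_one]
  rw [show -(2 * x) = -x + -x by ring, Real.exp_add]
  ring

lemma boxVar_nonneg {x : ℝ} (hx : 0 ≤ x) (i : ℕ) : 0 ≤ boxVar i x :=
  le_trans (by positivity) (le_boxVar hx i)

lemma weight_le_boxVar {x : ℝ} (hx : 0 ≤ x) (hx1 : x ≤ 1) (i : ℕ) :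
    weight i x ≤ 2 * Real.exp 2 * (i + 1).factorial * boxVar i x := by
  have h := le_boxVar hx i
  have h1 : weight i x ≤ 2 * x ^ (i + 1) := by
    have : x ^ (i + 2) ≤ x ^ (i + 1) := pow_le_pow_of_le_one hx hx1 (by omega)
    have e : Real.exp (-x) ≤ 1 := Real.exp_le_one_iff.2 (by linarith)
    unfold weight
    calc _ ≤ (x ^ (i + 1) + x ^ (i + 2)) * 1 := by gcongr
      _ ≤ _ := by linarith
  have h2 : 1 ≤ Real.exp 2 * Real.exp (-(2 * x)) := by
    rw [← Real.exp_add]; exact Real.one_le_exp (by linarith)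
  calc weight i x ≤ 2 * x ^ (i + 1) := h1
    _ ≤ 2 * x ^ (i + 1) * (Real.exp 2 * Real.exp (-(2 * x))) :=
        le_mul_of_one_le_right (by positivity) h2
    _ = 2 * Real.exp 2 * (i + 1).factorial *
        (x ^ (i + 1) * Real.exp (-(2 * x)) / (i + 1).factorial) := by field_simp
    _ ≤ _ := by gcongr

lemma boxVar_lower {x : ℝ} (hx : 1 ≤ x) (hx2 : x ≤ 2) (i : ℕ) :
    Real.exp (-4) / (i + 1).factorial ≤ boxVar i x := by
  refine le_trans ?_ (le_boxVar (by linarith) i)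
  gcongr
  calc Real.exp (-4) ≤ Real.exp (-(2 * x)) := Real.exp_le_exp.2 (by linarith)
    _ ≤ _ := le_mul_of_one_le_left (Real.exp_pos _).le (one_le_pow₀ hx)

/-- Decay of order x⁻² gives 4⁻ʳ on the r-th dyadic block, enough to beat its at most 2ʳ-fold growth
in boxes. -/
lemma weight_le_inv_sq {x : ℝ} (hx : 1 ≤ x) (i : ℕ) :
    weight i x ≤ (2 * (i + 4).factorial) * (x ^ 2)⁻¹ := by
  have h := pow_mul_exp_neg_le (show 0 ≤ x by linarith) (i + 4)
  have h1 : x ^ (i + 1) ≤ x ^ (i + 2) := pow_le_pow_right₀ hx (by omega)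
  rw [← div_eq_mul_inv, le_div_iff₀ (by positivity)]
  unfold weight
  calc _ ≤ (x ^ (i + 2) + x ^ (i + 2)) * Real.exp (-x) * x ^ 2 := by gcongr
    _ = 2 * (x ^ (i + 4) * Real.exp (-x)) := by ring
    _ ≤ _ := by gcongr

/-! ### Dyadic blocks of boxes -/

/-- The number of boxes whose expected content at time `s` lies in `[1, 2)`. -/
def blockCount (p : ℕ → ℝ) (s : ℝ) : ℝ := ({k | 1 ≤ s * p k ∧ s * p k < 2}.ncard : ℝ)

lemma finite_setOf_le_mul (hp : Summable p) {a : ℝ} (ha : 0 < a) (s : ℝ) :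
    {k | a ≤ s * p k}.Finite := by
  have h := ((hp.mul_left s).tendsto_cofinite_zero).eventually (gt_mem_nhds ha)
  rw [Filter.eventually_cofinite] at h
  simpa using h

/-- Translates asymptotics of `rho` into asymptotics of block sizes. -/
lemma rho_sub_rho_half (hp : Summable p) {s : ℝ} (hs : 0 < s) :
    rho p s - rho p (s / 2) = blockCount p s := by
  have e : ∀ t : ℝ, 0 < t → {k : ℕ | 0 < p k ∧ 1 / p k ≤ t} = {k | 1 ≤ t * p k} := by
    intro t ht
    ext k
    simp only [Set.mem_ofPred_eq]
    constructor
    · rintro ⟨h1, h2⟩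
      rwa [div_le_iff₀ h1] at h2
    · intro h
      have h1 : 0 < p k := by
        by_contra hn
        have : t * p k ≤ 0 := mul_nonpos_of_nonneg_of_nonpos ht.le (not_lt.1 hn)
        linarith
      exact ⟨h1, by rwa [div_le_iff₀ h1]⟩
  have hsub : {k | 1 ≤ s / 2 * p k} ⊆ {k | 1 ≤ s * p k} := by
    intro k hk
    have : 1 ≤ s / 2 * p k := hk
    show 1 ≤ s * p k
    linarith
  have hd : {k | 1 ≤ s * p k} \ {k | 1 ≤ s / 2 * p k} = {k | 1 ≤ s * p k ∧ s * p k < 2} := by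
    ext k
    simp only [Set.mem_sdiff, Set.mem_ofPred_eq, not_le]
    refine and_congr_right fun _ => ?_
    constructor <;> intro h <;> linarith
  have := Set.ncard_sdiff_add_ncard_of_subset hsub (finite_setOf_le_mul hp one_pos s)
  rw [hd] at this
  rw [rho, rho, e s hs, e (s / 2) (by positivity), ← this, blockCount]
  push_cast; ring

lemma blockCount_halving {s₀ : ℝ} (hs₀ : 0 < s₀)
    (h : ∀ s, s₀ ≤ s → blockCount p (s / 2) ≤ 2 * blockCount p s) (r : ℕ) (s : ℝ)
    (hs : s₀ ≤ s / 2 ^ r) : blockCount p (s / 2 ^ r) ≤ 2 ^ r * blockCount p s := by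
  induction r with
  | zero => simp
  | succ r ih =>
    have e : s / 2 ^ (r + 1) = s / 2 ^ r / 2 := by rw [pow_succ, div_div]
    rw [e] at hs ⊢
    have h1 : s₀ ≤ s / 2 ^ r := by linarith
    calc _ ≤ 2 * blockCount p (s / 2 ^ r) := h _ h1
      _ ≤ 2 * (2 ^ r * blockCount p s) := by
          have := ih h1; linarith
      _ = _ := by ring

/-- Under the halving condition the boxes with large expected content contribute at most a
multiple of one dyadic block. -/
lemma sum_inv_sq_le {s₀ : ℝ} (hs₀ : 0 < s₀) (hp : Summable p)
    (h : ∀ s, s₀ ≤ s → blockCount p (s / 2) ≤ 2 * blockCount p s) {s : ℝ} (hs : 0 < s)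
    (S : Finset ℕ) (hS : ∀ k ∈ S, 1 ≤ s * p k ∧ s₀ * p k ≤ 1) :
    ∑ k ∈ S, ((s * p k) ^ 2)⁻¹ ≤ 2 * blockCount p s := by
  classical
  let b : ℕ → ℕ := fun k => Nat.log 2 ⌊s * p k⌋₊
  have hb : ∀ k ∈ S, (2 : ℝ) ^ b k ≤ s * p k ∧ s * p k < 2 ^ (b k + 1) := by
    intro k hk
    have h1 := (hS k hk).1
    have hf : ⌊s * p k⌋₊ ≠ 0 := (Nat.floor_pos.2 h1).ne'
    constructor
    · have h2 := Nat.pow_log_le_self 2 hf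
      have h3 := Nat.floor_le (show 0 ≤ s * p k by linarith)
      refine le_trans ?_ h3
      exact_mod_cast h2
    · have h2 := Nat.lt_pow_succ_log_self (b := 2) one_lt_two ⌊s * p k⌋₊
      have h3 := (Nat.floor_lt (show 0 ≤ s * p k by linarith)).1 h2
      exact_mod_cast h3
  rw [← Finset.sum_fiberwise_of_maps_to (t := S.image b) (g := b)
    (fun k hk => Finset.mem_image_of_mem b hk)]
  have hfib : ∀ r ∈ S.image b, ∑ k ∈ S with b k = r, ((s * p k) ^ 2)⁻¹
      ≤ (1 / 2) ^ r * blockCount p s := by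
    intro r hr
    obtain ⟨k₀, hk₀, rfl⟩ := Finset.mem_image.1 hr
    -- The constraint s₀ p_k ≤ 1 keeps every scale used in the repeated halving above s₀.
    have h1 : s₀ ≤ s / 2 ^ b k₀ := by
      rw [le_div_iff₀ (by positivity)]
      have h2 := (hb k₀ hk₀).1
      have h3 := (hS k₀ hk₀).2
      calc s₀ * 2 ^ b k₀ ≤ s₀ * (s * p k₀) := by gcongr
        _ = s * (s₀ * p k₀) := by ring
        _ ≤ s := mul_le_of_le_one_right hs.le h3
    have h2 := blockCount_halving hs₀ h _ _ h1
    have h3 : ((S.filter fun k => b k = b k₀).card : ℝ) ≤ blockCount p (s / 2 ^ b k₀) := by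
      rw [blockCount, ← Set.ncard_coe_finset]
      have hfin : {k | 1 ≤ s / 2 ^ b k₀ * p k ∧ s / 2 ^ b k₀ * p k < 2}.Finite :=
        (finite_setOf_le_mul hp one_pos _).subset fun k hk => hk.1
      refine Nat.cast_le.2 (Set.ncard_le_ncard (fun k hk => ?_) hfin)
      rw [Finset.mem_coe, Finset.mem_filter] at hk
      have h4 := hb k hk.1
      rw [hk.2] at h4
      have e : s / 2 ^ b k₀ * p k = s * p k / 2 ^ b k₀ := by ring
      simp only [Set.mem_ofPred_eq, e]
      rw [le_div_iff₀ (by positivity), div_lt_iff₀ (by positivity), one_mul, ← pow_succ']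
      exact h4
    calc ∑ k ∈ S with b k = b k₀, ((s * p k) ^ 2)⁻¹
        ≤ ∑ k ∈ S with b k = b k₀, (((2 : ℝ) ^ b k₀) ^ 2)⁻¹ := by
          refine Finset.sum_le_sum fun k hk => ?_
          rw [Finset.mem_filter] at hk
          have h4 := (hb k hk.1).1
          rw [hk.2] at h4
          gcongr
      _ = (S.filter fun k => b k = b k₀).card * (((2 : ℝ) ^ b k₀) ^ 2)⁻¹ := by
          rw [Finset.sum_const, nsmul_eq_mul]
      _ ≤ (2 ^ b k₀ * blockCount p s) * (((2 : ℝ) ^ b k₀) ^ 2)⁻¹ := by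
          gcongr; exact h3.trans h2
      _ = _ := by
          rw [one_div, inv_pow]
          field_simp
  have hN : 0 ≤ blockCount p s := Nat.cast_nonneg _
  calc _ ≤ ∑ r ∈ S.image b, (1 / 2 : ℝ) ^ r * blockCount p s := Finset.sum_le_sum hfib
    _ = (∑ r ∈ S.image b, (1 / 2 : ℝ) ^ r) * blockCount p s := by rw [Finset.sum_mul]
    _ ≤ 2 * blockCount p s := by
        gcongr
        exact sum_le_hasSum _ (fun r _ => by positivity) hasSum_geometric_two

lemma summable_boxVar (hp0 : ∀ k, 0 ≤ p k) (hp : Summable p) (i n : ℕ) :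
    Summable fun k => boxVar i (n * p k) := by
  refine Summable.of_nonneg_of_le (fun k => boxVar_nonneg (mul_nonneg n.cast_nonneg (hp0 k)) i)
    (fun k => ?_) (hp.mul_left (n : ℝ))
  have hx : 0 ≤ (n : ℝ) * p k := mul_nonneg n.cast_nonneg (hp0 k)
  have h1 : poissonTail (n * p k) (i + 1) ≤ n * p k := by
    have hm : Antitone fun a => poissonTail (n * p k) a := antitone_nat_of_succ_le fun a => by
      rw [poissonTail_succ]; linarith [poissonMass_nonneg hx a]
    have h2 : poissonTail (n * p k) (i + 1) ≤ poissonTail (n * p k) 1 :=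
      hm (Nat.succ_le_succ (Nat.zero_le i))
    have h3 : poissonTail (n * p k) 1 = 1 - Real.exp (-(n * p k)) := by
      simp [poissonTail, poissonMass]
    have h4 := Real.add_one_le_exp (-(n * p k))
    linarith
  unfold boxVar
  refine le_trans (mul_le_of_le_one_right (poissonTail_nonneg hx _) ?_) h1
  linarith [poissonTail_nonneg hx (i + 1)]

/-- Under the halving condition, the total weight is at most a multiple of the variance of the
Poissonized count. -/
lemma eventually_totalWeight_le (hp0 : ∀ k, 0 ≤ p k) (hp : Summable p)
    (h2 : ∀ᶠ s in atTop, blockCount p (s / 2) ≤ 2 * blockCount p s)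
    (h1 : ∀ᶠ s in atTop, 1 ≤ blockCount p s) (i : ℕ) :
    ∃ C : ℝ, 0 < C ∧ ∀ᶠ n : ℕ in atTop,
      0 < ∑' k, boxVar i (n * p k) ∧ totalWeight p i n ≤ C * ∑' k, boxVar i (n * p k) := by
  classical
  obtain ⟨s₀, hs₀⟩ := eventually_atTop.1 (h2.and (eventually_ge_atTop 1))
  have hpos : 0 < s₀ := lt_of_lt_of_le one_pos (hs₀ s₀ le_rfl).2
  have hhalf : ∀ s, s₀ ≤ s → blockCount p (s / 2) ≤ 2 * blockCount p s := fun s hs => (hs₀ s hs).1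
  have hKfin : {k | 1 ≤ s₀ * p k}.Finite := finite_setOf_le_mul hp one_pos s₀
  -- These boxes may be too heavy for the halving condition, but there are finitely many, and their
  -- total weight tends to 0.
  set K := hKfin.toFinset with hK
  have hKlim : Tendsto (fun n : ℕ => ∑ k ∈ K, weight i (n * p k)) atTop (𝓝 0) := by
    rw [← Finset.sum_const_zero (s := K)]
    refine tendsto_finsetSum _ fun k hk => ?_
    have hk' : 1 ≤ s₀ * p k := by simpa [hK] using hk
    have hpk : 0 < p k := by
      rcases (hp0 k).eq_or_lt with h0 | h0
      · rw [← h0] at hk'; linarith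
      · exact h0
    have ht : Tendsto (fun n : ℕ => (n : ℝ) * p k) atTop atTop :=
      tendsto_natCast_atTop_atTop.atTop_mul_const hpk
    have e1 := (Real.tendsto_pow_mul_exp_neg_atTop_nhds_zero (i + 1)).comp ht
    have e2 := (Real.tendsto_pow_mul_exp_neg_atTop_nhds_zero (i + 2)).comp ht
    have e3 := e1.add e2
    rw [add_zero] at e3
    refine e3.congr fun n => ?_
    simp only [Function.comp, weight]; ring
  set c : ℝ := Real.exp (-4) / (i + 1).factorial with hc
  have hc0 : 0 < c := by positivity
  set C₁ : ℝ := 2 * Real.exp 2 * (i + 1).factorial with hC₁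
  set C₂ : ℝ := 2 * (i + 4).factorial with hC₂
  have hC₁0 : 0 < C₁ := by positivity
  have hC₂0 : 0 < C₂ := by positivity
  -- C₁ serves the boxes with n p_k ≤ 1, 2 C₂ the dyadic sum and 1 the finite set `K`; division by c
  -- converts the block at scale n into variance.
  refine ⟨C₁ + (2 * C₂ + 1) / c, by positivity, ?_⟩
  filter_upwards [eventually_gt_atTop 0, hKlim.eventually (gt_mem_nhds one_pos),
    tendsto_natCast_atTop_atTop.eventually h1] with n hn hKn hNn
  have hn' : (0 : ℝ) < n := by exact_mod_cast hn
  have hx : ∀ k, 0 ≤ (n : ℝ) * p k := fun k => mul_nonneg hn'.le (hp0 k)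
  set V := ∑' k, boxVar i (n * p k) with hV
  have hsV := summable_boxVar hp0 hp i n
  have hNV : c * blockCount p n ≤ V := by
    have hfin : {k | 1 ≤ (n : ℝ) * p k ∧ (n : ℝ) * p k < 2}.Finite :=
      (finite_setOf_le_mul hp one_pos _).subset fun k hk => hk.1
    calc c * blockCount p n = ∑ k ∈ hfin.toFinset, c := by
          rw [blockCount, Set.ncard_eq_toFinset_card _ hfin, Finset.sum_const, nsmul_eq_mul,
            mul_comm]
      _ ≤ ∑ k ∈ hfin.toFinset, boxVar i (n * p k) := by
          refine Finset.sum_le_sum fun k hk => ?_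
          have hk' : 1 ≤ (n : ℝ) * p k ∧ (n : ℝ) * p k < 2 := by simpa using hk
          exact boxVar_lower hk'.1 hk'.2.le i
      _ ≤ V := hsV.sum_le_tsum _ fun k _ => boxVar_nonneg (hx k) i
  have hVpos : 0 < V := by nlinarith
  refine ⟨hVpos, ?_⟩
  have hSfin : {k | 1 ≤ (n : ℝ) * p k ∧ s₀ * p k ≤ 1}.Finite :=
    (finite_setOf_le_mul hp one_pos n).subset fun k hk => hk.1
  set S := hSfin.toFinset with hS
  have hpt : ∀ k, weight i (n * p k) ≤ C₁ * boxVar i (n * p k)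
      + ((if k ∈ S then C₂ * ((n * p k) ^ 2)⁻¹ else 0)
        + (if k ∈ K then weight i (n * p k) else 0)) := by
    intro k
    have a1 : 0 ≤ C₁ * boxVar i (n * p k) := mul_nonneg hC₁0.le (boxVar_nonneg (hx k) i)
    have a2 : 0 ≤ (if k ∈ S then C₂ * ((n * p k) ^ 2)⁻¹ else 0) := by
      split_ifs
      · have := hx k
        positivity
      · exact le_rfl
    have a3 : 0 ≤ (if k ∈ K then weight i (n * p k) else 0) := by
      split_ifs
      exacts [weight_nonneg (hx k) i, le_rfl]
    rcases le_or_gt ((n : ℝ) * p k) 1 with hle | hgt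
    · have := weight_le_boxVar (hx k) hle i
      linarith
    · rcases le_or_gt (s₀ * p k) 1 with hle' | hgt'
      · rw [if_pos (show k ∈ S by simp [hS, hgt.le, hle'])]
        have := weight_le_inv_sq hgt.le i
        linarith
      · rw [if_pos (show k ∈ K by simp [hK, hgt'.le])]
        linarith
  have hs1 := hasSum_sum_of_ne_finset_zero (L := SummationFilter.unconditional ℕ)
    (f := fun k => if k ∈ S then C₂ * ((n * p k) ^ 2)⁻¹ else 0)
    (s := S) (fun k hk => if_neg hk)
  have hs2 := hasSum_sum_of_ne_finset_zero (L := SummationFilter.unconditional ℕ)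
    (f := fun k => if k ∈ K then weight i (n * p k) else 0)
    (s := K) (fun k hk => if_neg hk)
  have htot := hasSum_le hpt (summable_weight hp0 hp i n).hasSum
    ((hsV.hasSum.mul_left C₁).add (hs1.add hs2))
  have b1 : ∑ k ∈ S, (if k ∈ S then C₂ * (((n : ℝ) * p k) ^ 2)⁻¹ else 0)
      ≤ C₂ * (2 * blockCount p n) := by
    rw [Finset.sum_congr rfl fun k hk => if_pos hk, ← Finset.mul_sum]
    refine mul_le_mul_of_nonneg_left (sum_inv_sq_le hpos hp hhalf hn' S fun k hk => ?_) hC₂0.le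
    simpa [hS] using hk
  have b2 : ∑ k ∈ K, (if k ∈ K then weight i (n * p k) else 0) ≤ blockCount p n := by
    rw [Finset.sum_congr rfl fun k hk => if_pos hk]
    exact hKn.le.trans hNn
  have b3 : blockCount p n ≤ V / c := by
    rw [le_div_iff₀ hc0]; linarith
  calc totalWeight p i n ≤ C₁ * V + (C₂ * (2 * blockCount p n) + blockCount p n) :=
        htot.trans (by linarith)
    _ = C₁ * V + (2 * C₂ + 1) * blockCount p n := by ring
    _ ≤ C₁ * V + (2 * C₂ + 1) * (V / c) := by gcongr
    _ = _ := by ring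

/-! ### The halving condition under the regularity assumptions -/

lemma blockCount_halving_of_tendsto {a : ℝ → ℝ} {κ κ' : ℝ} (ha : ∀ᶠ s in atTop, 0 < a s)
    (hκ : 0 < κ) (hκ' : κ' ≤ κ)
    (h1 : Tendsto (fun s => blockCount p s / a s) atTop (𝓝 κ))
    (h2 : Tendsto (fun s => blockCount p (s / 2) / a s) atTop (𝓝 κ')) :
    (∀ᶠ s in atTop, blockCount p (s / 2) ≤ 2 * blockCount p s) ∧
      ∀ᶠ s in atTop, 1 ≤ blockCount p s := by
  -- The thresholds 3/4 and 3/2 lie on either side of 1 and differ by exactly the factor 2 of the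
  -- halving condition.
  have e1 := h1.eventually (lt_mem_nhds (show 3 / 4 * κ < κ by linarith))
  have e2 := h2.eventually (gt_mem_nhds (show κ' < 3 / 2 * κ by linarith))
  constructor
  · filter_upwards [ha, e1, e2] with s hs h3 h4
    rw [lt_div_iff₀ hs] at h3
    rw [div_lt_iff₀ hs] at h4
    linarith
  · filter_upwards [ha, e1] with s hs h3
    rw [lt_div_iff₀ hs] at h3
    have h5 : 0 < blockCount p s := lt_of_le_of_lt (by positivity) h3
    -- A block size is a natural number, so positivity already means at least 1.
    unfold blockCount at h5 ⊢
    exact_mod_cast h5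

lemma tendsto_half : Tendsto (fun s : ℝ => s / 2) atTop atTop :=
  tendsto_id.atTop_div_const two_pos

/-- Both blocks are increments of `rho` from s / 2, with ratios 2 and 1/2, so under the common
normalization ℓ(s / 2) both converge to log 2. -/
lemma blockCount_halving_of_deHaan (hp : Summable p) (h : DeHaanClassInfty (rho p)) :
    (∀ᶠ s in atTop, blockCount p (s / 2) ≤ 2 * blockCount p s) ∧
      ∀ᶠ s in atTop, 1 ≤ blockCount p s := by
  obtain ⟨l, hl, hinf⟩ := h
  refine blockCount_halving_of_tendsto (a := fun s => l (s / 2)) (κ := Real.log 2)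
    (κ' := Real.log 2) ((hinf.comp tendsto_half).eventually_gt_atTop 0)
    (Real.log_pos one_lt_two) le_rfl ?_ ?_
  · refine ((hl 2 two_pos).comp tendsto_half).congr' ?_
    filter_upwards [eventually_gt_atTop 0] with s hs
    rw [← rho_sub_rho_half hp hs, Function.comp_apply, show 2 * (s / 2) = s by ring]
  · have h3 := ((hl (1 / 2) (by norm_num)).neg.comp tendsto_half)
    rw [one_div, Real.log_inv, neg_neg] at h3
    refine h3.congr' ?_
    filter_upwards [eventually_gt_atTop 0] with s hs
    rw [← rho_sub_rho_half hp (by positivity : 0 < s / 2), Function.comp_apply,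
      show (2 : ℝ)⁻¹ * (s / 2) = s / 2 / 2 by ring]
    ring

/-- With β = 2^(-α) < 1, the normalized blocks at s and s / 2 tend to 1 - β and β (1 - β); the
second limit is the smaller. -/
lemma blockCount_halving_of_regularlyVarying (hp : Summable p) {α : ℝ} (hα : 0 < α)
    (h : RegularlyVarying (rho p) α) :
    (∀ᶠ s in atTop, blockCount p (s / 2) ≤ 2 * blockCount p s) ∧
      ∀ᶠ s in atTop, 1 ≤ blockCount p s := by
  obtain ⟨L, hL, hlim⟩ := h
  set a : ℝ → ℝ := fun s => s ^ α * L s with ha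
  have hapos : ∀ᶠ s in atTop, 0 < a s := by
    filter_upwards [hL.eventually_pos, eventually_gt_atTop 0] with s h1 h2
    exact mul_pos (Real.rpow_pos_of_pos h2 _) h1
  have hscale : ∀ c : ℝ, 0 < c → Tendsto (fun s => rho p (c * s) / a s) atTop (𝓝 (c ^ α)) := by
    intro c hc
    have hcs : Tendsto (fun s : ℝ => c * s) atTop atTop := tendsto_id.const_mul_atTop hc
    have h1 := (hlim.comp hcs).mul ((hL.tendsto_ratio c hc).const_mul (c ^ α))
    rw [one_mul, mul_one] at h1
    refine h1.congr' ?_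
    filter_upwards [hL.eventually_pos, hcs.eventually hL.eventually_pos, eventually_gt_atTop 0]
      with s h2 h3 h4
    have h5 : 0 < s ^ α := Real.rpow_pos_of_pos h4 _
    have h6 : 0 < c ^ α := Real.rpow_pos_of_pos hc _
    simp only [Function.comp_apply, ha]
    rw [Real.mul_rpow hc.le h4.le]
    field_simp
  set β : ℝ := (1 / 2 : ℝ) ^ α with hβ
  have hβ0 : 0 < β := by positivity
  have hβ1 : β < 1 := Real.rpow_lt_one (by norm_num) (by norm_num) hα
  have hβ2 : ((1 / 4 : ℝ)) ^ α = β * β := by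
    rw [hβ, ← Real.mul_rpow (by norm_num) (by norm_num)]; norm_num
  have q1 := hscale 1 one_pos
  rw [Real.one_rpow] at q1
  have q2 := hscale (1 / 2) (by norm_num)
  have q4 := hscale (1 / 4) (by norm_num)
  rw [hβ2] at q4
  refine blockCount_halving_of_tendsto (a := a) (κ := 1 - β) (κ' := β - β * β) hapos
    (by linarith) (by nlinarith) ?_ ?_
  · refine (q1.sub q2).congr' ?_
    filter_upwards [eventually_gt_atTop 0] with s hs
    rw [← rho_sub_rho_half hp hs, ← sub_div, one_mul, show 1 / 2 * s = s / 2 by ring]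
  · refine (q2.sub q4).congr' ?_
    filter_upwards [eventually_gt_atTop 0] with s hs
    rw [← rho_sub_rho_half hp (by positivity : 0 < s / 2), ← sub_div,
      show 1 / 2 * s = s / 2 by ring, show 1 / 4 * s = s / 2 / 2 by ring]

end Sums

/-! ### Comparison of the two variances -/

section Comparison

variable {Ω : Type*} [MeasurableSpace Ω] {P : Measure Ω} [IsProbabilityMeasure P]
  {p : ℕ → ℝ} {X : ℕ → Ω → ℕ} {ξ : ℕ → Ω → ℝ}

lemma hasSum_diagonal {f : ℕ → ℝ} {s : ℝ} (hf : HasSum f s) :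
    HasSum (fun c : ℕ × ℕ => if c.1 = c.2 then f c.1 else 0) s := by
  have hinj : Function.Injective fun k : ℕ => (k, k) := fun k l h => (Prod.ext_iff.1 h).1
  rw [← hinj.hasSum_iff]
  · simpa [Function.comp_def] using hf
  · rintro ⟨k, l⟩ hkl
    refine if_neg fun h => hkl ⟨k, ?_⟩
    have h' : k = l := h
    rw [h']

lemma variance_poissonCount (hp0 : ∀ k, 0 ≤ p k) (hp : Summable p) (h : IsScheme P p X ξ)
    (i n : ℕ) : variance (poissonCount X ξ (i + 1) n) P = ∑' k, boxVar i (n * p k) :=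
  (hasSum_variance_poissonCount h n.cast_nonneg (Nat.succ_pos i)).unique
    (hasSum_diagonal (summable_boxVar hp0 hp i n).hasSum)

/-- The linear term in `totalWeight` bounds the diagonal, via the Lipschitz bound for x (1 - x); the
quadratic term bounds the covariances of distinct boxes. -/
lemma abs_variance_sub_le (hp0 : ∀ k, 0 ≤ p k) (hp : HasSum p 1) (h : IsScheme P p X ξ)
    (i : ℕ) {n : ℕ} (hn : 0 < n) :
    |variance (detCount X (i + 1) n) P - variance (poissonCount X ξ (i + 1) n) P|
      ≤ Real.exp 1 ^ (2 * i + 1) / n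
        * (totalWeight p i n + totalWeight p i n * totalWeight p i n) := by
  have hp1 : ∀ k, p k ≤ 1 := fun k => le_hasSum hp k fun l _ => hp0 l
  have hp2 : ∀ k l, k ≠ l → p k + p l ≤ 1 := by
    intro k l hkl
    have := sum_le_hasSum {k, l} (fun l _ => hp0 l) hp
    rwa [Finset.sum_pair hkl] at this
  have hx : ∀ k, 0 ≤ (n : ℝ) * p k := fun k => mul_nonneg n.cast_nonneg (hp0 k)
  have hw : ∀ k, 0 ≤ weight i (n * p k) := fun k => weight_nonneg (hx k) i
  have h1 := (hasSum_variance_detCount h (Nat.succ_pos i) n).sub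
    (hasSum_variance_poissonCount h (Nat.cast_nonneg n) (Nat.succ_pos i))
  have hW := (summable_weight hp0 hp.summable i n).hasSum
  have h2 := ((hasSum_diagonal hW).add (hasSum_mul_self_of_nonneg hW hw)).mul_left
    (Real.exp 1 ^ (2 * i + 1) / n)
  refine h1.norm_le_of_bounded h2 fun c => ?_
  have hC : 0 ≤ Real.exp 1 ^ (2 * i + 1) / n := by positivity
  have hww := mul_nonneg hC (mul_nonneg (hw c.1) (hw c.2))
  rw [Real.norm_eq_abs, mul_add]
  split_ifs with hc
  · have h3 := abs_mul_one_sub_sub_le (binTail_mem_Icc (hp0 c.1) (hp1 c.1) n (i + 1))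
      ⟨poissonTail_nonneg (hx c.1) (i + 1), poissonTail_le_one (hx c.1) (i + 1)⟩
    have h4 := abs_binTail_sub_poissonTail_le_weight (hp0 c.1) (hp1 c.1) hn i
    exact (h3.trans h4).trans (le_add_of_nonneg_right hww)
  · rw [sub_zero, mul_zero, zero_add]
    exact abs_tailCov_le_weight (hp0 c.1) (hp0 c.2) (hp2 _ _ hc) hn i

lemma tendsto_variance_ratio (hp0 : ∀ k, 0 ≤ p k) (hp : HasSum p 1) (h : IsScheme P p X ξ)
    (h2 : ∀ᶠ s in atTop, blockCount p (s / 2) ≤ 2 * blockCount p s)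
    (h1 : ∀ᶠ s in atTop, 1 ≤ blockCount p s) (i : ℕ) :
    Tendsto (fun n : ℕ => variance (detCount X (i + 1) n) P
      / variance (poissonCount X ξ (i + 1) (n : ℝ)) P) atTop (𝓝 1) := by
  obtain ⟨C, hC, hev⟩ := eventually_totalWeight_le hp0 hp.summable h2 h1 i
  set B := Real.exp 1 ^ (2 * i + 1) with hB
  have hlim : Tendsto (fun n : ℕ => B * C * (1 / n + totalWeight p i n / n)) atTop (𝓝 0) := by
    have := (tendsto_one_div_atTop_nhds_zero_nat.add
      (tendsto_totalWeight_div hp0 hp.summable i)).const_mul (B * C)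
    simpa using this
  rw [tendsto_iff_norm_sub_tendsto_zero]
  refine squeeze_zero' (Eventually.of_forall fun n => norm_nonneg _) ?_ hlim
  filter_upwards [hev, eventually_gt_atTop 0] with n hn hn0
  have hd := abs_variance_sub_le hp0 hp h i hn0
  rw [variance_poissonCount hp0 hp.summable h] at hd ⊢
  set V := ∑' k, boxVar i (n * p k) with hV
  obtain ⟨hVpos, hWV⟩ := hn
  have hn' : (0 : ℝ) < n := by exact_mod_cast hn0
  have hW0 : 0 ≤ totalWeight p i n :=
    tsum_nonneg fun k => weight_nonneg (mul_nonneg hn'.le (hp0 k)) i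
  have e : variance (detCount X (i + 1) n) P / V - 1
      = (variance (detCount X (i + 1) n) P - V) / V := by field_simp
  rw [e, Real.norm_eq_abs, abs_div, abs_of_pos hVpos, div_le_iff₀ hVpos]
  calc _ ≤ B / n * (totalWeight p i n + totalWeight p i n * totalWeight p i n) := hd
    -- Only one factor of W² is traded for C V; the other, divided by n, supplies the convergence to
    -- 0.
    _ ≤ B / n * (C * V + totalWeight p i n * (C * V)) := by gcongr
    _ = _ := by field_simp

end Comparison

end

end Karlin

theorem proposition3p4 {Ω : Type*} [MeasurableSpace Ω] (P : Measure Ω) [IsProbabilityMeasure P]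
    (p : ℕ → ℝ) (hp_nonneg : ∀ k, 0 ≤ p k) (hp_sum : HasSum p 1)
    (hp_inf : {k : ℕ | 0 < p k}.Infinite)
    (X : ℕ → Ω → ℕ) (ξ : ℕ → Ω → ℝ) (hscheme : Karlin.IsScheme P p X ξ)
    (hrho : Karlin.DeHaanClassInfty (Karlin.rho p) ∨
      ∃ α : ℝ, 0 < α ∧ α ≤ 1 ∧ Karlin.RegularlyVarying (Karlin.rho p) α)
    (j : ℕ) (hj : 1 ≤ j) :
    (∀ n : ℕ, MemLp (Karlin.detCount X j n) 2 P) ∧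
    (∀ n : ℕ, MemLp (Karlin.poissonCount X ξ j (n : ℝ)) 2 P) ∧
    Tendsto (fun n : ℕ =>
        variance (Karlin.detCount X j n) P / variance (Karlin.poissonCount X ξ j (n : ℝ)) P)
      atTop (𝓝 1) := by
  refine ⟨fun n => Karlin.memLp_detCount hscheme hj n,
    fun n => Karlin.memLp_poissonCount hscheme n.cast_nonneg hj, ?_⟩
  obtain ⟨i, rfl⟩ : ∃ i, j = i + 1 := ⟨j - 1, by omega⟩
  have hblock : (∀ᶠ s in atTop, Karlin.blockCount p (s / 2) ≤ 2 * Karlin.blockCount p s) ∧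
      ∀ᶠ s in atTop, 1 ≤ Karlin.blockCount p s := by
    rcases hrho with h | ⟨α, hα, -, h⟩
    · exact Karlin.blockCount_halving_of_deHaan hp_sum.summable h
    · exact Karlin.blockCount_halving_of_regularlyVarying hp_sum.summable hα h
  exact Karlin.tendsto_variance_ratio hp_nonneg hp_sum hscheme hblock.1 hblock.2 i
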